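/- Let $\Bbbk$ be a commutative ring, $G$ a topological group, $L,R\subseteq G$ subgroups, $X$ a left $L$-space, and $A\colon X\to G/R$ a continuous $L$-equivariant map. Cohomology is sheaf cohomology with coefficients in $\Bbbk$. A principal bundle is called universal if its total space is contractible. For a left $G$-space $E$ such that the quotient maps $E\to L\backslash E$ and $E\to R\backslash E$ are universal principal $L$- and $R$-bundles, respectively, put $$H_L^\bullet(X,\Bbbk)=H^\bullet(L\backslash(X\times E),\Bbbk),\qquad H_L^\bullet(\mathrm{pt},\Bbbk)=H^\bullet(L\backslash E,\Bbbk),\qquad H_R^\bullet(\mathrm{pt},\Bbbk)=H^\bullet(R\backslash E,\Bbbk),$$ where $L$ acts diagonally on $X\times E$. Let $\mathrm{can}\colon L\backslash(X\times E)\to L\backslash E$ be the map $L(x,e)\mapsto Le$, and let $v_A\colon L\backslash(X\times E)\to R\backslash E$ be the map $L(x,e)\mapsto A(x)^{-1}e$ (that is, $L(x,e)\mapsto Rg^{-1}e$ if $A(x)=gR$). Then $H_L^\bullet(X,\Bbbk)$ is an $H_L^\bullet(\mathrm{pt},\Bbbk)$-$H_R^\bullet(\mathrm{pt},\Bbbk)$-bimodule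 with the left action $am=\mathrm{can}^*(a)\cup m$ and the right action $mb=m\cup v_A^*(b)$. Up to isomorphism, this bimodule does not depend on the choice of $E$: if $\widetilde E$ is another left $G$-space such that $\widetilde E\to L\backslash\widetilde E$ and $\widetilde E\to R\backslash\widetilde E$ are universal principal $L$- and $R$-bundles, and $\widetilde H$ denotes the objects defined as above with $\widetilde E$ in place of $E$, then there exist isomorphisms of graded $\Bbbk$-algebras $$\iota_L\colon H_L^\bullet(\mathrm{pt},\Bbbk)\to\widetilde H_L^\bullet(\mathrm{pt},\Bbbk),\qquad \iota_R\colon H_R^\bullet(\mathrm{pt},\Bbbk)\to\widetilde H_R^\bullet(\mathrm{pt},\Bbbk)$$ and an isomorphism of graded $\Bbbk$-modules $\mu\colon H_L^\bullet(X,\Bbbk)\to\widetilde H_L^\bullet(X,\Bbbk)$ such that $\mu(am)=\iota_L(a)\mu(m)$ and $\mu(mb)=\mu(m)\iota_R(b)$ for all $a\in H_L^\bullet(\mathrm{pt},\Bbbk)$, $m\in H_L^\bullet(X,\Bbbk)$ and $b\in H_R^\bullet(\mathrm{pt},\Bbbk)$. -/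

import Mathlib

open CategoryTheory Limits TopologicalSpace Abelian
open scoped DirectSum MulOpposite

universe u

namespace EquivCoh

noncomputable section

/-! ### Sheaves of `k`-modules on a topological space -/

section Sheaves

variable (k : Type u) [CommRing k] {X Y : TopCat.{u}}

/-- The category of sheaves of `k`-modules on `X` is `k`-linear. -/
instance sheafLinear (X : TopCat.{u}) : Linear k (TopCat.Sheaf (ModuleCat.{u} k) X) :=
  inferInstanceAs (Linear k (ObjectProperty.FullSubcategory _))

attribute [local instance] reflectsLimits_of_reflectsIsomorphisms in
/-- The inverse image functor on sheaves of `k`-modules is left exact. -/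
instance pullbackPreservesFiniteLimits (f : X ⟶ Y) :
    PreservesFiniteLimits (TopCat.Sheaf.pullback (ModuleCat.{u} k) f) := by
  delta TopCat.Sheaf.pullback
  exact Functor.sheafPullbackConstruction.preservesFiniteLimits _ _ _ _

/-- The inverse image functor on sheaves of `k`-modules is additive. -/
instance pullbackAdditive (f : X ⟶ Y) :
    (TopCat.Sheaf.pullback (ModuleCat.{u} k) f).Additive :=
  Functor.additive_of_preserves_binary_products _

/-- The inverse image functor on sheaves of `k`-modules is `k`-linear. -/
instance pullbackLinear (f : X ⟶ Y) :
    (TopCat.Sheaf.pullback (ModuleCat.{u} k) f).Linear k where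
  map_smul {F F'} g r := by
    apply ((TopCat.Sheaf.pullbackPushforwardAdjunction (ModuleCat.{u} k) f).homEquiv _ _).injective
    rw [Adjunction.homEquiv_unit, Adjunction.homEquiv_unit]
    have h : (TopCat.Sheaf.pushforward (ModuleCat.{u} k) f).map
        (r • (TopCat.Sheaf.pullback (ModuleCat.{u} k) f).map g) =
        r • (TopCat.Sheaf.pushforward (ModuleCat.{u} k) f).map
          ((TopCat.Sheaf.pullback (ModuleCat.{u} k) f).map g) := rfl
    rw [h, Linear.comp_smul]
    have e := (TopCat.Sheaf.pullbackPushforwardAdjunction (ModuleCat.{u} k) f).unit.naturality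
    have e1 := e g
    have e2 := e (r • g)
    dsimp at e1 e2
    rw [← e1, ← e2, Linear.smul_comp]

/-- The constant sheaf `k_X`. -/
abbrev constSheaf (X : TopCat.{u}) : TopCat.Sheaf (ModuleCat.{u} k) X :=
  (constantSheaf (Opens.grothendieckTopology X) (ModuleCat.{u} k)).obj (ModuleCat.of k k)

/-- The canonical isomorphism `f⁻¹ k_Y ≅ k_X`: both `M ↦ f⁻¹ M_Y` and `M ↦ M_X` are left adjoint
to the functor of global sections on sheaves on `X`. -/
def constSheafPullbackIso (f : X ⟶ Y) :
    (TopCat.Sheaf.pullback (ModuleCat.{u} k) f).obj (constSheaf k Y) ≅ constSheaf k X :=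
  (Adjunction.leftAdjointUniq
    (((constantSheafAdj (Opens.grothendieckTopology Y) (ModuleCat.{u} k)
        (isTerminalTop : IsTerminal (⊤ : Opens Y))).comp
      (TopCat.Sheaf.pullbackPushforwardAdjunction (ModuleCat.{u} k) f)).ofNatIsoRight
        (Iso.refl _ : _ ≅ (sheafSections (Opens.grothendieckTopology X) (ModuleCat.{u} k)).obj
          (Opposite.op ⊤)))
    (constantSheafAdj (Opens.grothendieckTopology X) (ModuleCat.{u} k)
        (isTerminalTop : IsTerminal (⊤ : Opens X)))).app (ModuleCat.of k k)

end Sheaves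

/-! ### Sheaf cohomology with constant coefficients as a graded ring -/

section Cohomology

variable (k : Type u) [CommRing k]

/-- The sheaf cohomology `Hⁿ(X, k) = Extⁿ(k_X, k_X)`, that is, the `n`-th right derived functor
of the functor of global sections `Hom(k_X, -)` at the constant sheaf `k_X`. -/
def HDeg (X : Type u) [TopologicalSpace X] (n : ℕ) : Type u :=
  Ext (constSheaf k (TopCat.of X)) (constSheaf k (TopCat.of X)) n

instance cohAddCommGroup (X : Type u) [TopologicalSpace X] (n : ℕ) : AddCommGroup (HDeg k X n) :=
  inferInstanceAs (AddCommGroup (Ext _ _ n))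

instance cohModule (X : Type u) [TopologicalSpace X] (n : ℕ) : Module k (HDeg k X n) :=
  inferInstanceAs (Module k (Ext _ _ n))

variable (X : Type u) [TopologicalSpace X]

/-- The cup product. As `k_X` is the unit for the tensor product of sheaves of `k`-modules, the cup
product `a ∪ b = a ⊗ b` of two classes `a : k_X ⟶ k_X[i]` and `b : k_X ⟶ k_X[j]` is the
composition `a ∘ b : k_X ⟶ k_X[i + j]` in the derived category. -/
def cup {i j : ℕ} (a : HDeg k X i) (b : HDeg k X j) : HDeg k X (i + j) :=
  Ext.comp b a (add_comm j i)

/-- The unit `1 : k_X ⟶ k_X` of the cup product. -/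
def unit : HDeg k X 0 := Ext.mk₀ (𝟙 _)

lemma mk_comp_eq {i j n m : ℕ} (a : HDeg k X i) (b : HDeg k X j) (h : i + j = n)
    (h' : i + j = m) : GradedMonoid.mk n (Ext.comp a b h : HDeg k X n) =
      GradedMonoid.mk m (Ext.comp a b h' : HDeg k X m) := by
  subst h; subst h'; rfl

lemma mk_cup_unit (r : k) {n : ℕ} (a : HDeg k X n) :
    GradedMonoid.mk (n + 0) (cup k X a (r • unit k X)) = GradedMonoid.mk n (r • a) := by
  refine (mk_comp_eq k X _ _ _ (zero_add n)).trans (congrArg _ ?_)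
  refine (Ext.smul_comp _ _ _ _).trans ?_
  exact congrArg _ (Ext.mk₀_id_comp a)

lemma mk_unit_cup (r : k) {n : ℕ} (a : HDeg k X n) :
    GradedMonoid.mk (0 + n) (cup k X (r • unit k X) a) = GradedMonoid.mk n (r • a) := by
  refine (mk_comp_eq k X _ _ _ (add_zero n)).trans (congrArg _ ?_)
  refine (Ext.comp_smul _ _ _ _).trans ?_
  exact congrArg _ (Ext.comp_mk₀_id a)

instance cohGMul : GradedMonoid.GMul (HDeg k X) where
  mul a b := cup k X a b

instance cohGOne : GradedMonoid.GOne (HDeg k X) where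
  one := unit k X

lemma mk_cup_assoc {l m n : ℕ} (a : HDeg k X l) (b : HDeg k X m) (c : HDeg k X n) :
    GradedMonoid.mk (l + m + n) (cup k X (cup k X a b) c) =
      GradedMonoid.mk (l + (m + n)) (cup k X a (cup k X b c)) := by
  have h := Ext.comp_assoc c b a (add_comm n m) (add_comm m l) (by omega : n + m + l = l + m + n)
  refine Eq.trans (congrArg (GradedMonoid.mk (l + m + n)) h.symm) ?_
  exact mk_comp_eq k X (Ext.comp c b (add_comm n m) : HDeg k X (m + n)) a _ _

lemma cup_zero {i j : ℕ} (a : HDeg k X i) : cup k X a (0 : HDeg k X j) = 0 :=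
  Ext.zero_comp _ _ _ _ _

lemma zero_cup {i j : ℕ} (b : HDeg k X j) : cup k X (0 : HDeg k X i) b = 0 :=
  Ext.comp_zero _ _ _ _ _

lemma cup_add {i j : ℕ} (a : HDeg k X i) (b c : HDeg k X j) :
    cup k X a (b + c) = cup k X a b + cup k X a c :=
  Ext.add_comp _ _ _ _

lemma add_cup {i j : ℕ} (a b : HDeg k X i) (c : HDeg k X j) :
    cup k X (a + b) c = cup k X a c + cup k X b c :=
  Ext.comp_add _ _ _ _

instance cohGRing : DirectSum.GRing (HDeg k X) where
  one_mul := by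
    rintro ⟨n, a⟩
    have h := mk_unit_cup k X 1 a
    rw [one_smul, one_smul] at h
    exact h
  mul_one := by
    rintro ⟨n, a⟩
    have h := mk_cup_unit k X 1 a
    rw [one_smul, one_smul] at h
    exact h
  mul_assoc := by
    rintro ⟨l, a⟩ ⟨m, b⟩ ⟨n, c⟩
    exact mk_cup_assoc k X a b c
  mul_zero a := cup_zero k X a
  zero_mul b := zero_cup k X b
  mul_add a b c := cup_add k X a b c
  add_mul a b c := add_cup k X a b c
  natCast n := n • unit k X
  natCast_zero := zero_nsmul (unit k X)
  natCast_succ n := succ_nsmul (unit k X) n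
  intCast n := n • unit k X
  intCast_ofNat n := natCast_zsmul (unit k X) n
  intCast_negSucc_ofNat n := negSucc_zsmul (unit k X) n

instance cohGAlgebra : DirectSum.GAlgebra k (HDeg k X) where
  toFun :=
    { toFun := fun r => r • unit k X
      map_zero' := zero_smul _ _
      map_add' := fun r s => add_smul r s _ }
  map_one := one_smul k (unit k X)
  map_mul r s := by
    change GradedMonoid.mk 0 ((r * s) • unit k X) =
      GradedMonoid.mk (0 + 0) (cup k X (r • unit k X) (s • unit k X))
    rw [mk_unit_cup, mul_smul]
  commutes := by
    rintro r ⟨n, a⟩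
    change GradedMonoid.mk (0 + n) (cup k X (r • unit k X) a) =
      GradedMonoid.mk (n + 0) (cup k X a (r • unit k X))
    rw [mk_unit_cup, mk_cup_unit]
  smul_def := by
    rintro r ⟨n, a⟩
    change GradedMonoid.mk n (r • a) = GradedMonoid.mk (0 + n) (cup k X (r • unit k X) a)
    rw [mk_unit_cup]

/-- The graded `k`-algebra `H^•(X, k)` with the cup product as multiplication. -/
abbrev H : Type u := ⨁ n, HDeg k X n

/-- The elements of `H^•(X, k)` that are homogeneous of degree `n`. -/
def homog (n : ℕ) : Submodule k (H k X) := LinearMap.range (DirectSum.lof k ℕ (HDeg k X) n)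

end Cohomology

/-! ### Pull-back in cohomology -/

section Pullback

/-- Conjugation by an isomorphism `e : A ≅ B` on `Ext`-groups. -/
def extConj (k : Type u) [CommRing k] {C : Type*} [Category C] [Abelian C] [Linear k C]
    [HasExt.{u} C] {A B : C} (e : A ≅ B) (n : ℕ) : Ext A A n →ₗ[k] Ext B B n :=
  (Ext.precompOfLinear (Ext.mk₀ e.inv) k B (zero_add n)).comp
    (Ext.postcompOfLinear (Ext.mk₀ e.hom) k A (add_zero n))

lemma extConj_comp (k : Type u) [CommRing k] {C : Type*} [Category C] [Abelian C] [Linear k C]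
    [HasExt.{u} C] {A B : C} (e : A ≅ B) {i j n : ℕ} (h : i + j = n) (x : Ext A A i)
    (y : Ext A A j) :
    extConj k e n (x.comp y h) = (extConj k e i x).comp (extConj k e j y) h := by
  change (Ext.mk₀ e.inv).comp ((x.comp y h).comp (Ext.mk₀ e.hom) (add_zero n)) (zero_add n) =
    ((Ext.mk₀ e.inv).comp (x.comp (Ext.mk₀ e.hom) (add_zero i)) (zero_add i)).comp
      ((Ext.mk₀ e.inv).comp (y.comp (Ext.mk₀ e.hom) (add_zero j)) (zero_add j)) h
  rw [Ext.comp_assoc _ _ _ (zero_add i) h (by omega),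
    Ext.comp_assoc _ _ _ (add_zero i) (zero_add j) (by omega), Ext.mk₀_comp_mk₀_assoc,
    e.hom_inv_id, Ext.mk₀_id_comp, Ext.comp_assoc _ _ _ h (add_zero j) (by omega)]

lemma extConj_id (k : Type u) [CommRing k] {C : Type*} [Category C] [Abelian C] [Linear k C]
    [HasExt.{u} C] {A B : C} (e : A ≅ B) : extConj k e 0 (Ext.mk₀ (𝟙 A)) = Ext.mk₀ (𝟙 B) := by
  change (Ext.mk₀ e.inv).comp ((Ext.mk₀ (𝟙 A)).comp (Ext.mk₀ e.hom) (add_zero 0)) (zero_add 0) = _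
  rw [Ext.mk₀_comp_mk₀, Ext.mk₀_comp_mk₀, Category.id_comp, e.inv_hom_id]

variable (k : Type u) [CommRing k] {X Y : Type u} [TopologicalSpace X] [TopologicalSpace Y]

/-- The pull-back `f^* : Hⁿ(Y, k) → Hⁿ(X, k)`: apply the exact functor `f⁻¹` to a class in
`Extⁿ(k_Y, k_Y)` and identify `f⁻¹ k_Y` with `k_X`. -/
def pullbackDeg (f : C(X, Y)) (n : ℕ) : HDeg k Y n →ₗ[k] HDeg k X n :=
  (extConj k (constSheafPullbackIso k (TopCat.ofHom f)) n).comp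
    ((TopCat.Sheaf.pullback (ModuleCat.{u} k) (TopCat.ofHom f)).mapExtLinearMap k _ _ n)

lemma pullbackDeg_unit (f : C(X, Y)) : pullbackDeg k f 0 (unit k Y) = unit k X := by
  refine Eq.trans (congrArg (extConj k _ 0) ?_)
    (extConj_id k (constSheafPullbackIso k (TopCat.ofHom f)))
  refine (Ext.mapExactFunctor_mk₀ _ _).trans (congrArg _ ?_)
  exact CategoryTheory.Functor.map_id _ _

lemma pullbackDeg_cup (f : C(X, Y)) {i j : ℕ} (a : HDeg k Y i) (b : HDeg k Y j) :
    pullbackDeg k f (i + j) (cup k Y a b) =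
      cup k X (pullbackDeg k f i a) (pullbackDeg k f j b) := by
  refine Eq.trans (congrArg (extConj k _ _) ?_)
    (extConj_comp k (constSheafPullbackIso k (TopCat.ofHom f)) (add_comm j i) _ _)
  exact Ext.mapExactFunctor_comp _ _ _ _

/-- The pull-back `f^* : H^•(Y, k) → H^•(X, k)`. -/
def pullback (f : C(X, Y)) : H k Y →ₐ[k] H k X :=
  DirectSum.toAlgebra k _ (fun n => (DirectSum.lof k ℕ (HDeg k X) n).comp (pullbackDeg k f n))
    (congrArg (DirectSum.lof k ℕ (HDeg k X) 0) (pullbackDeg_unit k f))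
    (fun {i j} a b => by
      refine (congrArg (DirectSum.lof k ℕ (HDeg k X) (i + j)) (pullbackDeg_cup k f a b)).trans ?_
      exact (DirectSum.of_mul_of _ _).symm)

end Pullback

/-! ### Group actions, principal bundles and the Borel construction -/

section Topology

/-- The quotient space `G \ X` of a left `G`-space. -/
abbrev OrbitSpace (G X : Type u) [Group G] [MulAction G X] : Type u :=
  MulAction.orbitRel.Quotient G X

/-- The quotient map `X → G \ X`. -/
def orbitMap (G X : Type u) [Group G] [MulAction G X] (x : X) : OrbitSpace G X :=
  Quotient.mk (MulAction.orbitRel G X) x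

/-- A principal `G`-bundle for a left `G`-space `E`: a continuous map `p : E → B` such that each
point of `B` has an open neighbourhood `U` with a `G`-equivariant homeomorphism
`h : G × U ≃ p⁻¹(U)` over `U`. -/
structure IsPrincipalBundle (G : Type u) {E B : Type u} [Group G] [TopologicalSpace G]
    [TopologicalSpace E] [TopologicalSpace B] [MulAction G E] (p : E → B) : Prop where
  continuous : Continuous p
  locally_trivial : ∀ b : B, ∃ U : Set B, IsOpen U ∧ b ∈ U ∧ ∃ h : (G × U) ≃ₜ (p ⁻¹' U),
    (∀ (g : G) (u : U), p (h (g, u)) = u) ∧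
    ∀ (g₁ g₂ : G) (u : U), (h (g₁ * g₂, u) : E) = g₁ • (h (g₂, u) : E)

/-- A principal `G`-bundle is universal if its total space is contractible. -/
structure IsUniversalPrincipalBundle (G : Type u) {E B : Type u} [Group G] [TopologicalSpace G]
    [TopologicalSpace E] [TopologicalSpace B] [MulAction G E] (p : E → B) : Prop
    extends IsPrincipalBundle G p where
  contractible : ContractibleSpace E

/-- The Borel construction `X ×_L E = L \ (X × E)` for the diagonal action of `L`. -/
abbrev Borel (L X E : Type u) [Group L] [MulAction L X] [MulAction L E] : Type u :=
  OrbitSpace L (X × E)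

/-- The canonical projection `X ×_L E → L \ E`, `L(x, e) ↦ Le`. -/
def can (L X E : Type u) [Group L] [TopologicalSpace X] [TopologicalSpace E] [MulAction L X]
    [MulAction L E] : C(Borel L X E, OrbitSpace L E) where
  toFun := Quotient.lift (fun z => orbitMap L E z.2) (by
    rintro _ b ⟨l, rfl⟩
    exact Quotient.sound ⟨l, rfl⟩)
  continuous_toFun := Continuous.quotient_lift (continuous_quotient_mk'.comp continuous_snd) _

variable {G : Type u} [Group G] [TopologicalSpace G] (L R : Subgroup G)

/-- A twisting map: a continuous `L`-equivariant map `A : X → G / R`. -/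
structure TwistingMap (X : Type u) [TopologicalSpace X] [MulAction L X] extends C(X, G ⧸ R) where
  map_smul' : ∀ (l : L) (x : X), toFun (l • x) = (l : G) • toFun x

/-- The map `G / R × E → R \ E`, `(gR, e) ↦ R g⁻¹ e`. -/
def cosetInvSMul (E : Type u) [MulAction G E] (c : G ⧸ R) (e : E) : OrbitSpace R E :=
  Quotient.liftOn' c (fun g => orbitMap R E (g⁻¹ • e)) (by
    intro a b hab
    rw [QuotientGroup.leftRel_apply] at hab
    refine Quotient.sound ⟨⟨a⁻¹ * b, hab⟩, ?_⟩
    change (a⁻¹ * b) • b⁻¹ • e = a⁻¹ • e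
    rw [smul_smul, mul_assoc, mul_inv_cancel, mul_one])

lemma continuous_cosetInvSMul [IsTopologicalGroup G] (E : Type u) [TopologicalSpace E]
    [MulAction G E] [ContinuousSMul G E] :
    Continuous (fun z : (G ⧸ R) × E => cosetInvSMul R E z.1 z.2) := by
  have hq : Topology.IsQuotientMap
      (Prod.map (QuotientGroup.mk : G → G ⧸ R) (id : E → E)) :=
    (QuotientGroup.isOpenQuotientMap_mk.prodMap IsOpenQuotientMap.id).isQuotientMap
  rw [hq.continuous_iff]
  exact continuous_quotient_mk'.comp (continuous_fst.inv.smul continuous_snd)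

variable {L R}

/-- The projection twisted by `A`: `v_A : X ×_L E → R \ E`, `L(x, e) ↦ A(x)⁻¹ e`. -/
def twistedProj [IsTopologicalGroup G] {X : Type u} [TopologicalSpace X] [MulAction L X]
    (A : TwistingMap L R X) (E : Type u) [TopologicalSpace E] [MulAction G E]
    [ContinuousSMul G E] : C(Borel L X E, OrbitSpace R E) where
  toFun := Quotient.lift (fun z => cosetInvSMul R E (A.toFun z.1) z.2) (by
    rintro _ ⟨x, e⟩ ⟨l, rfl⟩
    change cosetInvSMul R E (A.toFun (l • x)) ((l : G) • e) = cosetInvSMul R E (A.toFun x) e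
    rw [A.map_smul']
    induction A.toFun x using QuotientGroup.induction_on with
    | H g =>
      change orbitMap R E (((l : G) * g)⁻¹ • (l : G) • e) = orbitMap R E (g⁻¹ • e)
      rw [smul_smul, mul_inv_rev, inv_mul_cancel_right])
  continuous_toFun := Continuous.quotient_lift
    ((continuous_cosetInvSMul R E).comp
      ((A.continuous_toFun.comp continuous_fst).prodMk continuous_snd)) _

end Topology

/-! ### The twisted bimodule -/

section Bimodule

variable (k : Type u) [CommRing k] {G : Type u} [Group G] [TopologicalSpace G]
  [IsTopologicalGroup G] {L R : Subgroup G} {X : Type u} [TopologicalSpace X] [MulAction L X]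
  (A : TwistingMap L R X) (E : Type u) [TopologicalSpace E] [MulAction G E] [ContinuousSMul G E]

/-- The equivariant cohomology `H_L^•(X, k) = H^•(X ×_L E, k)` computed with `E`. The twisting map
`A` is recorded since the right action below depends on it. -/
def EquivariantCohomology (_A : TwistingMap L R X) : Type u := H k (Borel L X E)

instance : AddCommGroup (EquivariantCohomology k E A) :=
  inferInstanceAs (AddCommGroup (H k (Borel L X E)))

instance : Module k (EquivariantCohomology k E A) :=
  inferInstanceAs (Module k (H k (Borel L X E)))

/-- The canonical left action of `H_L^•(pt, k) = H^•(L \ E, k)`: `a m = can^*(a) ∪ m`. -/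
instance : Module (H k (OrbitSpace L E)) (EquivariantCohomology k E A) :=
  Module.compHom (H k (Borel L X E)) (pullback k (can L X E)).toRingHom

/-- The right action of `H_R^•(pt, k) = H^•(R \ E, k)` twisted by `A`: `m b = m ∪ v_A^*(b)`. -/
instance : Module (H k (OrbitSpace R E))ᵐᵒᵖ (EquivariantCohomology k E A) :=
  Module.compHom (H k (Borel L X E)) (pullback k (twistedProj A E)).toRingHom.op

/-- The identity map from the bimodule to the ring `H^•(X ×_L E, k)` underlying it. -/
def EquivariantCohomology.toH : EquivariantCohomology k E A ≃ₗ[k] H k (Borel L X E) :=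
  LinearEquiv.refl k (H k (Borel L X E))

lemma toH_smul (a : H k (OrbitSpace L E)) (m : EquivariantCohomology k E A) :
    EquivariantCohomology.toH k A E (a • m) =
      pullback k (can L X E) a * EquivariantCohomology.toH k A E m := rfl

lemma toH_op_smul (b : H k (OrbitSpace R E)) (m : EquivariantCohomology k E A) :
    EquivariantCohomology.toH k A E (MulOpposite.op b • m) =
      EquivariantCohomology.toH k A E m * pullback k (twistedProj A E) b := rfl

/-- The two actions make `H_L^•(X, k)` a bimodule. -/
instance : SMulCommClass (H k (OrbitSpace L E)) (H k (OrbitSpace R E))ᵐᵒᵖ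
    (EquivariantCohomology k E A) where
  smul_comm a b m := (mul_assoc (pullback k (can L X E) a) (m : H k (Borel L X E))
    (pullback k (twistedProj A E) b.unop)).symm

/-- The elements of `H_L^•(X, k)` that are homogeneous of degree `n`. -/
def EquivariantCohomology.homog (n : ℕ) : Submodule k (EquivariantCohomology k E A) :=
  EquivCoh.homog k (Borel L X E) n

end Bimodule

end

end EquivCoh

/-! Both `E` and `E'` are compared with `E × E'` under the diagonal action of `G`. The two
projections give a roof `L \ E ← L \ (E × E') → L \ E'`, and likewise for `R` and for `L \ (X × -)`.
If every leg induces isomorphisms in cohomology, then `(g^*)⁻¹ f^*` along each roof is an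
isomorphism of graded algebras. The maps `can` and `v_A` are natural for `G`-equivariant maps, so
they are morphisms of roofs; hence these isomorphisms respect both actions (`roof_pullback`).

Each leg is a fibre bundle with fibre `E` or `E'`. Local triviality of the principal bundle supplies
equivariant maps to the group, locally over the orbit space, and these untwist the diagonal action
(`HasLocalCoordinates.isFibreBundle`). Such maps pull back along equivariant maps, which covers `X ×
E` as well.

It remains to prove that a fibre bundle `p : Y → B` with contractible fibre `F` induces isomorphisms
in cohomology, for arbitrary spaces (`IsFibreBundle.pullbackDeg_bijective`). By a degenerate Leray
argument (`bijective_ext_of_adjunction`, `pullbackDeg_bijective`) it suffices that `k_B = p_* k_Y`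
and that the higher direct images vanish. The first holds because the fibres are connected. For the
second, excision reduces to `U × F → U`, where homotopy invariance shows that classes come from `U`,
and classes of positive degree on `U` vanish locally.

Homotopy invariance follows from the same criterion for `X × [0, 1] → X`. There the higher direct
images vanish because local lifts of sections can be glued along a finite subdivision of the
interval (`exists_lift_cylinder`). Throughout, `Ext` out of the free sheaf on an open set plays the
role of the cohomology of that set, and statements on `Ext` are proved by dimension shifting along
embeddings into injectives. -/

namespace EquivCoh

noncomputable section

/-! ### Dimension shifting, exact functors on `Ext`, and the degenerate Leray argument -/

section ExtFunctoriality

universe w w' w'' v v' v'' u₁ u₂ u₃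

variable {C : Type u₁} [Category.{v} C] [Abelian C] [HasExt.{w} C]
  {D : Type u₂} [Category.{v'} D] [Abelian D] [HasExt.{w'} D]
  {E : Type u₃} [Category.{v''} E] [Abelian E] [HasExt.{w''} E]

/-- Every class of positive degree is the product of a class of lower degree with the class of a
short exact sequence whose middle term is injective. -/
lemma exists_comp_extClass [EnoughInjectives C] {A B : C} {n : ℕ} (x : Ext A B (n + 1)) :
    ∃ (J Q : C) (_ : Injective J) (i : B ⟶ J) (p : J ⟶ Q) (h : i ≫ p = 0)
      (hS : (ShortComplex.mk i p h).ShortExact) (y : Ext A Q n),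
      x = y.comp hS.extClass rfl := by
  let I : InjectivePresentation B := Classical.arbitrary _
  have hS : (ShortComplex.mk I.f (cokernel.π I.f) (cokernel.condition _)).ShortExact :=
    { exact := ShortComplex.exact_cokernel _ }
  obtain ⟨y, hy⟩ := Ext.covariant_sequence_exact₁ A hS x
    (@Ext.eq_zero_of_injective _ _ _ _ _ _ _ I.injective _) rfl
  exact ⟨_, _, I.injective, _, _, _, hS, y, hy.symm⟩

lemma mapExactFunctor_extClass_mk (F : C ⥤ D) [F.Additive] [PreservesFiniteLimits F]
    [PreservesFiniteColimits F] {A J Q : C} {i : A ⟶ J} {p : J ⟶ Q} {h : i ≫ p = 0}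
    (hS : (ShortComplex.mk i p h).ShortExact) {h' : F.map i ≫ F.map p = 0}
    (hFS : (ShortComplex.mk (F.map i) (F.map p) h').ShortExact) :
    hS.extClass.mapExactFunctor F = hFS.extClass :=
  Ext.mapExactFunctor_extClass F hS

lemma extClass_naturality_mk {A J Q A' J' Q' : C} {i : A ⟶ J} {p : J ⟶ Q} {h : i ≫ p = 0}
    (hS : (ShortComplex.mk i p h).ShortExact) {i' : A' ⟶ J'} {p' : J' ⟶ Q'} {h' : i' ≫ p' = 0}
    (hS' : (ShortComplex.mk i' p' h').ShortExact) (a : A ⟶ A') (b : J ⟶ J') (c : Q ⟶ Q')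
    (h₁ : a ≫ i' = i ≫ b) (h₂ : b ≫ p' = p ≫ c) :
    hS.extClass.comp (Ext.mk₀ a) (add_zero 1) = (Ext.mk₀ c).comp hS'.extClass (zero_add 1) :=
  ShortComplex.ShortExact.extClass_naturality hS hS' ⟨a, b, c, h₁, h₂⟩

lemma shortExact_map_mk (F : C ⥤ D) [F.Additive] [PreservesFiniteLimits F]
    [PreservesFiniteColimits F] {A J Q : C} {i : A ⟶ J} {p : J ⟶ Q} {h : i ≫ p = 0}
    (hS : (ShortComplex.mk i p h).ShortExact) :
    ∃ h' : F.map i ≫ F.map p = 0, (ShortComplex.mk (F.map i) (F.map p) h').ShortExact :=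
  ⟨by rw [← F.map_comp, h, F.map_zero], hS.map_of_exact F⟩

/-- Dimension shifting reduces this to degree 0, where it is naturality of `τ`, and to naturality of
extension classes. The target is a composite because inverse images compose only up to a comparison
morphism. -/
lemma mapExactFunctor_comp_naturality [EnoughInjectives C]
    {F : C ⥤ E} [F.Additive] [PreservesFiniteLimits F] [PreservesFiniteColimits F]
    {G : C ⥤ D} [G.Additive] [PreservesFiniteLimits G] [PreservesFiniteColimits G]
    {H : D ⥤ E} [H.Additive] [PreservesFiniteLimits H] [PreservesFiniteColimits H]
    (τ : F ⟶ G ⋙ H) {A B : C} {n : ℕ} (x : Ext A B n) :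
    (x.mapExactFunctor F).comp (Ext.mk₀ (τ.app B)) (add_zero n) =
      (Ext.mk₀ (τ.app A)).comp ((x.mapExactFunctor G).mapExactFunctor H) (zero_add n) := by
  induction n generalizing B with
  | zero =>
    obtain ⟨f, rfl⟩ := (Ext.mk₀_bijective A B).2 x
    simp only [Ext.mapExactFunctor_mk₀, Ext.mk₀_comp_mk₀]
    exact congrArg _ (τ.naturality f)
  | succ n ih =>
    obtain ⟨J, Q, hJ, i, p, h, hS, y, rfl⟩ := exists_comp_extClass x
    obtain ⟨hF, hFS⟩ := shortExact_map_mk F hS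
    obtain ⟨hG, hGS⟩ := shortExact_map_mk G hS
    obtain ⟨hH, hHS⟩ := shortExact_map_mk H hGS
    have e := extClass_naturality_mk hFS hHS (τ.app B) (τ.app J) (τ.app Q)
      (τ.naturality i).symm (τ.naturality p).symm
    rw [Ext.mapExactFunctor_comp, Ext.mapExactFunctor_comp, Ext.mapExactFunctor_comp,
      mapExactFunctor_extClass_mk F hS hFS, mapExactFunctor_extClass_mk G hS hGS,
      mapExactFunctor_extClass_mk H hGS hHS, Ext.comp_assoc _ _ _ rfl (add_zero 1) (by omega)]
    refine (congrArg (fun z => Ext.comp _ z _) e).trans ?_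
    rw [← Ext.comp_assoc _ _ _ (add_zero n) (zero_add 1) (by omega)]
    refine (congrArg (fun z => Ext.comp z _ _) (ih y)).trans ?_
    rw [Ext.comp_assoc _ _ _ (zero_add n) rfl (by omega)]

lemma mapExactFunctor_id [EnoughInjectives C] {A B : C} {n : ℕ} (x : Ext A B n) :
    x.mapExactFunctor (𝟭 C) = x := by
  induction n generalizing B with
  | zero =>
    obtain ⟨f, rfl⟩ := (Ext.mk₀_bijective A B).2 x
    rw [Ext.mapExactFunctor_mk₀]
    rfl
  | succ n ih =>
    obtain ⟨J, Q, hJ, i, p, h, hS, y, rfl⟩ := exists_comp_extClass x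
    rw [Ext.mapExactFunctor_comp, Ext.mapExactFunctor_extClass]
    exact congrArg (fun z => Ext.comp z _ _) (ih y)

lemma mapExactFunctor_id_naturality [EnoughInjectives C] {F : C ⥤ C} [F.Additive]
    [PreservesFiniteLimits F] [PreservesFiniteColimits F] (τ : F ⟶ 𝟭 C) {A B : C}
    {n : ℕ} (x : Ext A B n) :
    (x.mapExactFunctor F).comp (Ext.mk₀ (τ.app B)) (add_zero n) =
      (Ext.mk₀ (τ.app A)).comp x (zero_add n) := by
  have h := mapExactFunctor_comp_naturality (F := F) (G := 𝟭 C) (H := 𝟭 C) τ x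
  rwa [mapExactFunctor_id, mapExactFunctor_id] at h

/-- A degenerate Leray spectral sequence: if `R` is right adjoint to the exact functor `L`, and if
`M` has a resolution by injective objects that remains exact under `R`, then
`Ext(N, R M) = Ext(L N, M)`. The predicate `P` is one that passes from `M` to the cokernels
of embeddings into injective objects. -/
theorem bijective_ext_of_adjunction [EnoughInjectives D] {L : C ⥤ D} {R : D ⥤ C} (adj : L ⊣ R)
    [L.Additive] [PreservesFiniteLimits L] [PreservesFiniteColimits L] (P : D → Prop)
    (hP : ∀ ⦃M J Q : D⦄ (i : M ⟶ J) (p : J ⟶ Q) (h : i ≫ p = 0),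
      (ShortComplex.mk i p h).ShortExact → Injective J → P M → Epi (R.map p) ∧ P Q)
    (N : C) {M : D} (hM : P M) (n : ℕ) :
    Function.Bijective (fun x : Ext N (R.obj M) n =>
      (x.mapExactFunctor L).comp (Ext.mk₀ (adj.counit.app M)) (add_zero n)) := by
  have hR : R.Additive := adj.right_adjoint_additive
  have hinj : ∀ {J : D}, Injective J → Injective (R.obj J) := fun hJ =>
    Injective.injective_of_adjoint adj _
  have hRl : R.IsRightAdjoint := adj.isRightAdjoint
  -- In degree 0 the map is the adjunction bijection. No condition `P M` is imposed, since this is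
  -- also applied to the injective object `J`.
  have zero_case : ∀ M : D, Function.Bijective (fun x : Ext N (R.obj M) 0 =>
      (x.mapExactFunctor L).comp (Ext.mk₀ (adj.counit.app M)) (add_zero 0)) := by
    intro M
    have e : (fun x : Ext N (R.obj M) 0 =>
      (x.mapExactFunctor L).comp (Ext.mk₀ (adj.counit.app M)) (add_zero 0)) ∘ Ext.mk₀ =
        Ext.mk₀ ∘ (adj.homEquiv N M).symm := by
      funext f
      simp only [Function.comp_apply, Ext.mapExactFunctor_mk₀, Ext.mk₀_comp_mk₀,
        Adjunction.homEquiv_counit]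
    rw [← Function.Bijective.of_comp_iff _ (Ext.mk₀_bijective N (R.obj M)), e]
    exact (Ext.mk₀_bijective _ _).comp (adj.homEquiv N M).symm.bijective
  induction n generalizing M with
  | zero => exact zero_case M
  | succ n ih =>
    obtain ⟨J, Q, hJ, i, p, h, hS⟩ : ∃ (J Q : D) (_ : Injective J) (i : M ⟶ J) (p : J ⟶ Q)
        (h : i ≫ p = 0), (ShortComplex.mk i p h).ShortExact := by
      let I : InjectivePresentation M := Classical.arbitrary _
      exact ⟨_, _, I.injective, I.f, cokernel.π I.f, cokernel.condition _,
        { exact := ShortComplex.exact_cokernel _ }⟩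
    obtain ⟨hepi, hQ⟩ := hP i p h hS hJ hM
    have hRi : R.map i ≫ R.map p = 0 := by rw [← R.map_comp, h, R.map_zero]
    -- As a right adjoint, `R` is left exact; only the epimorphism needs `P`.
    have hRS : (ShortComplex.mk (R.map i) (R.map p) hRi).ShortExact :=
      { exact := by
          have : Mono i := hS.mono_f
          exact hS.exact.map_of_mono_of_preservesKernel R inferInstance inferInstance
        mono_f := by
          have : Mono i := hS.mono_f
          exact inferInstanceAs (Mono (R.map i))
        epi_g := hepi }
    obtain ⟨hL, hLS⟩ := shortExact_map_mk L hRS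
    have nat := extClass_naturality_mk hLS hS (adj.counit.app M) (adj.counit.app J)
      (adj.counit.app Q) (adj.counit.naturality i).symm (adj.counit.naturality p).symm
    -- The comparison map commutes with the connecting maps, because the counit is a morphism of
    -- short exact sequences.
    have key : ∀ v : Ext N (R.obj Q) n,
        (Ext.mapExactFunctor L (v.comp hRS.extClass rfl)).comp (Ext.mk₀ (adj.counit.app M))
          (add_zero (n + 1)) =
        ((v.mapExactFunctor L).comp (Ext.mk₀ (adj.counit.app Q)) (add_zero n)).comp
          hS.extClass rfl := by
      intro v
      rw [Ext.mapExactFunctor_comp, mapExactFunctor_extClass_mk L hRS hLS,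
        Ext.comp_assoc _ _ _ rfl (add_zero 1) (by omega)]
      refine (congrArg (fun z => Ext.comp _ z _) nat).trans ?_
      rw [← Ext.comp_assoc _ _ _ (add_zero n) (zero_add 1) (by omega)]
    have hRJ := hinj hJ
    have surj : ∀ x : Ext N (R.obj M) (n + 1), ∃ v : Ext N (R.obj Q) n,
        v.comp hRS.extClass rfl = x := fun x =>
      Ext.covariant_sequence_exact₁ N hRS x
        (@Ext.eq_zero_of_injective _ _ _ _ _ _ _ hRJ _) rfl
    constructor
    · have hinj0 : ∀ x : Ext N (R.obj M) (n + 1),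
        (x.mapExactFunctor L).comp (Ext.mk₀ (adj.counit.app M)) (add_zero (n + 1)) = 0 →
          x = 0 := by
        intro x hx
        obtain ⟨v, rfl⟩ := surj x
        rw [key] at hx
        obtain ⟨w, hw⟩ := Ext.covariant_sequence_exact₃ _ hS _ _ hx
        -- In degree 0 the class `w` lifts by adjunction; in positive degree it vanishes since `J`
        -- is injective.
        have hw' : ∃ w' : Ext N (R.obj J) n,
            (w'.mapExactFunctor L).comp (Ext.mk₀ (adj.counit.app J)) (add_zero n) = w := by
          cases n with
          | zero => exact (zero_case J).2 w
          | succ m => exact ⟨0, by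
              rw [Ext.mapExactFunctor_zero, Ext.zero_comp]
              exact (Ext.eq_zero_of_injective w).symm⟩
        obtain ⟨w', rfl⟩ := hw'
        have hv : w'.comp (Ext.mk₀ (R.map p)) (add_zero n) = v := by
          apply (ih hQ).1
          dsimp only
          rw [← hw, Ext.mapExactFunctor_comp, Ext.mapExactFunctor_mk₀,
            Ext.comp_assoc_of_second_deg_zero, Ext.comp_assoc_of_second_deg_zero,
            Ext.mk₀_comp_mk₀, Ext.mk₀_comp_mk₀]
          exact congrArg (fun z => Ext.comp _ (Ext.mk₀ z) _) (adj.counit.naturality p)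
        rw [← hv, Ext.comp_assoc_of_second_deg_zero]
        refine (congrArg (fun z => Ext.comp _ z _) hRS.comp_extClass).trans (Ext.comp_zero _ _ _ _ _)
      intro x y hxy
      rw [← sub_eq_zero]
      apply hinj0
      have : Ext.mapExactFunctor L (x - y) = Ext.mapExactFunctor L x - Ext.mapExactFunctor L y :=
        map_sub (L.mapExtAddHom _ _ _) x y
      rw [this, sub_eq_add_neg, Ext.add_comp, Ext.neg_comp, ← sub_eq_add_neg, sub_eq_zero]
      exact hxy
    · intro z
      obtain ⟨w, rfl⟩ := Ext.covariant_sequence_exact₁ _ hS z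
        (@Ext.eq_zero_of_injective _ _ _ _ _ _ _ hJ _) rfl
      obtain ⟨v, rfl⟩ := (ih hQ).2 w
      exact ⟨v.comp hRS.extClass rfl, key v⟩

end ExtFunctoriality

/-! ### Sections of sheaves and the objects representing them -/

section Sections

open Opposite

variable {k : Type u} [CommRing k] {X Y : TopCat.{u}}

/-- The sections of a sheaf of `k`-modules over an open set. -/
abbrev Sec (F : TopCat.Sheaf (ModuleCat.{u} k) X) (W : Opens X) : ModuleCat.{u} k :=
  F.obj.obj (op W)

/-- The action of a morphism of sheaves on sections over an open set. -/
def mapSec {F F' : TopCat.Sheaf (ModuleCat.{u} k) X} (φ : F ⟶ F') (W : Opens X) :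
    Sec F W →ₗ[k] Sec F' W :=
  (φ.hom.app (op W)).hom

/-- Restriction of sections. -/
def resSec (F : TopCat.Sheaf (ModuleCat.{u} k) X) {W W' : Opens X} (h : W' ≤ W) :
    Sec F W →ₗ[k] Sec F W' :=
  (F.obj.map (homOfLE h).op).hom

@[simp] lemma mapSec_comp {F F' F'' : TopCat.Sheaf (ModuleCat.{u} k) X} (φ : F ⟶ F')
    (ψ : F' ⟶ F'') (W : Opens X) (s : Sec F W) :
    mapSec (φ ≫ ψ) W s = mapSec ψ W (mapSec φ W s) := rfl

@[simp] lemma resSec_self (F : TopCat.Sheaf (ModuleCat.{u} k) X) {W : Opens X} (h : W ≤ W)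
    (s : Sec F W) : resSec F h s = s :=
  congrArg (fun f => ModuleCat.Hom.hom f s) (F.obj.map_id (op W))

@[simp] lemma resSec_resSec (F : TopCat.Sheaf (ModuleCat.{u} k) X) {W W' W'' : Opens X}
    (h : W' ≤ W) (h' : W'' ≤ W') (s : Sec F W) :
    resSec F h' (resSec F h s) = resSec F (h'.trans h) s :=
  congrArg (fun f => ModuleCat.Hom.hom f s)
    (F.obj.map_comp (homOfLE h).op (homOfLE h').op).symm

lemma mapSec_resSec {F F' : TopCat.Sheaf (ModuleCat.{u} k) X} (φ : F ⟶ F') {W W' : Opens X}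
    (h : W' ≤ W) (s : Sec F W) :
    mapSec φ W' (resSec F h s) = resSec F' h (mapSec φ W s) :=
  congrArg (fun f => ModuleCat.Hom.hom f s) (φ.hom.naturality (homOfLE h).op)

lemma resSec_eq_of_cover (F : TopCat.Sheaf (ModuleCat.{u} k) X) {W : Opens X} (s t : Sec F W)
    (h : ∀ x ∈ W, ∃ (W' : Opens X) (hW' : W' ≤ W), x ∈ W' ∧ resSec F hW' s = resSec F hW' t) :
    s = t := by
  choose V hV hx hst using h
  refine TopCat.Sheaf.eq_of_locally_eq' F (fun x : W => V x.1 x.2) W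
    (fun x => homOfLE (hV x.1 x.2)) (fun x hxW => ?_) s t fun x => hst x.1 x.2
  exact Opens.mem_iSup.2 ⟨⟨x, hxW⟩, hx x hxW⟩

/-- A section `a` of `A` over `W` is universal if each section over `W` of any sheaf is the image
of `a` under a unique morphism. -/
def IsUniversalSec {A : TopCat.Sheaf (ModuleCat.{u} k) X} {W : Opens X} (a : Sec A W) : Prop :=
  ∀ F : TopCat.Sheaf (ModuleCat.{u} k) X, Function.Bijective fun φ : A ⟶ F => mapSec φ W a

variable (k) in
/-- The unit section of the constant sheaf. -/
def oneSec (X : TopCat.{u}) : Sec (constSheaf k X) ⊤ :=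
  ((constantSheafAdj (Opens.grothendieckTopology X) (ModuleCat.{u} k)
    (isTerminalTop : IsTerminal (⊤ : Opens X))).unit.app (ModuleCat.of k k)).hom (1 : k)

/-- By adjunction, a morphism out of `k_X` is a linear map from `k` to the global sections, which is
determined by its value at 1. Identities between morphisms out of constant sheaves can thus be
checked on one section. -/
lemma oneSec_universal : IsUniversalSec (oneSec k X) := by
  intro F
  let e := ((constantSheafAdj (Opens.grothendieckTopology X) (ModuleCat.{u} k)
    (isTerminalTop : IsTerminal (⊤ : Opens X))).homEquiv (ModuleCat.of k k) F).trans
    (ModuleCat.homEquiv.trans (LinearMap.ringLmapEquivSelf k k (Sec F ⊤)).toEquiv)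
  have h : (fun φ : constSheaf k X ⟶ F => mapSec φ ⊤ (oneSec k X)) = e := by
    funext φ
    simp [e, ModuleCat.homEquiv]
    rfl
  rw [h]
  exact e.bijective

variable (k) in
/-- The free sheaf of `k`-modules generated by a section over `W`. -/
def freeSheaf (W : Opens X) : TopCat.Sheaf (ModuleCat.{u} k) X :=
  (presheafToSheaf (Opens.grothendieckTopology X) (ModuleCat.{u} k)).obj
    (yoneda.obj W ⋙ ModuleCat.free k)

/-- The equivalence between morphisms from `freeSheaf k W` and sections over `W`. -/
def freeSheafEquiv (W : Opens X) (F : TopCat.Sheaf (ModuleCat.{u} k) X) :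
    (freeSheaf k W ⟶ F) ≃ Sec F W :=
  ((sheafificationAdjunction (Opens.grothendieckTopology X) (ModuleCat.{u} k)).homEquiv _ F).trans
    ((((ModuleCat.adj k).whiskerRight (Opens X)ᵒᵖ).homEquiv (yoneda.obj W) F.obj).trans
      yonedaEquiv)

lemma freeSheafEquiv_comp {W : Opens X} {F F' : TopCat.Sheaf (ModuleCat.{u} k) X}
    (φ : freeSheaf k W ⟶ F) (ψ : F ⟶ F') :
    freeSheafEquiv W F' (φ ≫ ψ) = mapSec ψ W (freeSheafEquiv W F φ) := by
  have h₁ := (sheafificationAdjunction (Opens.grothendieckTopology X)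
    (ModuleCat.{u} k)).homEquiv_naturality_right φ ψ
  have h₂ := ((ModuleCat.adj k).whiskerRight (Opens X)ᵒᵖ).homEquiv_naturality_right
    ((sheafificationAdjunction (Opens.grothendieckTopology X)
      (ModuleCat.{u} k)).homEquiv (yoneda.obj W ⋙ ModuleCat.free k) F φ) ψ.hom
  refine (congrArg yonedaEquiv ((congrArg (((ModuleCat.adj k).whiskerRight (Opens X)ᵒᵖ).homEquiv
    (yoneda.obj W) F'.obj) h₁).trans h₂)).trans ?_
  exact yonedaEquiv_comp _ _

lemma freeSheafEquiv_map_comp {W W' : Opens X} {F : TopCat.Sheaf (ModuleCat.{u} k) X}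
    (h : W' ≤ W) (φ : freeSheaf k W ⟶ F) :
    freeSheafEquiv W' F ((presheafToSheaf (Opens.grothendieckTopology X)
      (ModuleCat.{u} k)).map (Functor.whiskerRight (yoneda.map (homOfLE h))
        (ModuleCat.free k)) ≫ φ) = resSec F h (freeSheafEquiv W F φ) := by
  have h₁ := (sheafificationAdjunction (Opens.grothendieckTopology X)
    (ModuleCat.{u} k)).homEquiv_naturality_left (Functor.whiskerRight (yoneda.map (homOfLE h))
        (ModuleCat.free k)) φ
  have h₂ := ((ModuleCat.adj k).whiskerRight (Opens X)ᵒᵖ).homEquiv_naturality_left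
    (yoneda.map (homOfLE h)) ((sheafificationAdjunction (Opens.grothendieckTopology X)
      (ModuleCat.{u} k)).homEquiv (yoneda.obj W ⋙ ModuleCat.free k) F φ)
  refine (congrArg yonedaEquiv ((congrArg (((ModuleCat.adj k).whiskerRight (Opens X)ᵒᵖ).homEquiv
    (yoneda.obj W') F.obj) h₁).trans h₂)).trans ?_
  exact (yonedaEquiv_naturality _ _).symm

variable (k) in
/-- The generator of `freeSheaf k W`. -/
def gen (W : Opens X) : Sec (freeSheaf k W) W := freeSheafEquiv W _ (𝟙 _)

lemma gen_universal (W : Opens X) : IsUniversalSec (gen k W) := by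
  intro F
  have h : (fun φ : freeSheaf k W ⟶ F => mapSec φ W (gen k W)) = freeSheafEquiv W F := by
    funext φ
    rw [gen, ← freeSheafEquiv_comp, Category.id_comp]
  rw [h]
  exact (freeSheafEquiv W F).bijective

/-- The inclusion of free sheaves induced by an inclusion of open sets. -/
def freeIncl {W W' : Opens X} (h : W' ≤ W) : freeSheaf k W' ⟶ freeSheaf k W :=
  (freeSheafEquiv W' _).symm (resSec _ h (gen k W))

lemma IsUniversalSec.hom_ext {A F : TopCat.Sheaf (ModuleCat.{u} k) X} {W : Opens X} {a : Sec A W}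
    (ha : IsUniversalSec a) {φ ψ : A ⟶ F} (h : mapSec φ W a = mapSec ψ W a) : φ = ψ :=
  (ha F).1 h

lemma mapSec_freeSheafEquiv_symm {W : Opens X} {F : TopCat.Sheaf (ModuleCat.{u} k) X}
    (s : Sec F W) : mapSec ((freeSheafEquiv W F).symm s) W (gen k W) = s := by
  rw [gen, ← freeSheafEquiv_comp, Category.id_comp, Equiv.apply_symm_apply]

@[simp] lemma mapSec_freeIncl {W W' : Opens X} (h : W' ≤ W) :
    mapSec (freeIncl h) W' (gen k W') = resSec _ h (gen k W) :=
  mapSec_freeSheafEquiv_symm _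

@[simp] lemma freeIncl_comp {W W' W'' : Opens X} (h : W' ≤ W) (h' : W'' ≤ W') :
    freeIncl (k := k) h' ≫ freeIncl h = freeIncl (h'.trans h) := by
  apply (gen_universal _).hom_ext
  simp [mapSec_resSec]

/-- Before sheafification this is an injection of free modules on sets with at most one element, and
sheafification preserves monomorphisms. -/
instance {W W' : Opens X} (h : W' ≤ W) : Mono (freeIncl (k := k) h) := by
  have key : freeIncl (k := k) h = (presheafToSheaf (Opens.grothendieckTopology X)
      (ModuleCat.{u} k)).map (Functor.whiskerRight (yoneda.map (homOfLE h))
        (ModuleCat.free k)) := by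
    apply (freeSheafEquiv W' _).injective
    have e := freeSheafEquiv_map_comp (k := k) h (𝟙 _)
    exact (Equiv.apply_symm_apply _ _).trans
      (e.symm.trans (congrArg (freeSheafEquiv W' _) (Category.comp_id _)))
  have : Mono (Functor.whiskerRight (yoneda.map (homOfLE h)) (ModuleCat.free k)) := by
    have : ∀ U, Mono ((Functor.whiskerRight (yoneda.map (homOfLE h)) (ModuleCat.free k)).app U) := by
      intro U
      rw [ModuleCat.mono_iff_injective]
      exact Finsupp.mapDomain_injective fun (a b : U.unop ⟶ W') _ => Subsingleton.elim a b
    exact NatTrans.mono_of_mono_app _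
  rw [key]
  exact Functor.map_mono (presheafToSheaf (Opens.grothendieckTopology X) (ModuleCat.{u} k)) _

end Sections

/-! ### Local lifting, constant sheaves, and pull-back of sections -/

section LocalSections

open Opposite

variable {k : Type u} [CommRing k] {X Y : TopCat.{u}}

lemma epi_iff_locally_lift {F F' : TopCat.Sheaf (ModuleCat.{u} k) X} (φ : F ⟶ F') :
    Epi φ ↔ ∀ (W : Opens X) (s : Sec F' W), ∀ x ∈ W, ∃ (W' : Opens X) (h : W' ≤ W), x ∈ W' ∧
      ∃ t : Sec F W', mapSec φ W' t = resSec F' h s := by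
  rw [← TopCat.Sheaf.isLocallySurjective_iff_epi, TopCat.Presheaf.isLocallySurjective_iff]
  constructor
  · intro H W s x hx
    obtain ⟨V, hV, ⟨t, ht⟩, hxV⟩ := H W s x hx
    exact ⟨V, hV, hxV, t, ht⟩
  · intro H W s x hx
    obtain ⟨V, hV, hxV, t, ht⟩ := H W s x hx
    exact ⟨V, hV, ⟨t, ht⟩, hxV⟩

lemma mapSec_injective {F F' : TopCat.Sheaf (ModuleCat.{u} k) X} (φ : F ⟶ F') [Mono φ]
    (W : Opens X) : Function.Injective (mapSec φ W) := by
  intro s t h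
  apply (freeSheafEquiv W F).symm.injective
  rw [← cancel_mono φ]
  apply (gen_universal W).hom_ext
  simpa [mapSec_freeSheafEquiv_symm] using h

/-- Left exactness of sections: regarded as a morphism from the free sheaf, `s` is killed by `p`,
hence factors through the kernel. -/
lemma exists_mapSec_eq_of_exact {A J Q : TopCat.Sheaf (ModuleCat.{u} k) X} {i : A ⟶ J} {p : J ⟶ Q}
    {h : i ≫ p = 0} (hS : (ShortComplex.mk i p h).ShortExact) {W : Opens X} (s : Sec J W)
    (hs : mapSec p W s = 0) : ∃ t : Sec A W, mapSec i W t = s := by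
  have := hS.mono_f
  have h0 : (freeSheafEquiv W J).symm s ≫ p = 0 := by
    apply (gen_universal W).hom_ext
    rw [mapSec_comp, mapSec_freeSheafEquiv_symm, hs]
    rfl
  let l := hS.exact.lift _ h0
  refine ⟨mapSec l W (gen k W), ?_⟩
  rw [← mapSec_comp]
  have : l ≫ i = (freeSheafEquiv W J).symm s := hS.exact.lift_f _ h0
  rw [this, mapSec_freeSheafEquiv_symm]

/-- Injective sheaves are flabby: a section is a morphism from a free sheaf, and it extends along
the monomorphism `freeIncl h`. -/
lemma exists_resSec_eq_of_injective (J : TopCat.Sheaf (ModuleCat.{u} k) X) [Injective J]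
    {W W' : Opens X} (h : W' ≤ W) (s : Sec J W') : ∃ t : Sec J W, resSec J h t = s := by
  refine ⟨mapSec (Injective.factorThru ((freeSheafEquiv W' J).symm s) (freeIncl h)) W (gen k W), ?_⟩
  rw [← mapSec_resSec, ← mapSec_freeIncl, ← mapSec_comp, Injective.comp_factorThru,
    mapSec_freeSheafEquiv_symm]

/-- With this formula, local surjectivity and local injectivity of sheafification say that sections
of `k_X` are locally multiples of 1, with a coefficient that is unique over nonempty open sets. -/
lemma toSheafify_const_apply (W : Opens X) (r : k) :
    ((toSheafify (Opens.grothendieckTopology X)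
      ((Functor.const _).obj (ModuleCat.of k k) : (Opens X)ᵒᵖ ⥤ ModuleCat.{u} k)).app (op W)).hom r =
      r • resSec (constSheaf k X) (le_top : W ≤ ⊤) (oneSec k X) := by
  have h₁ : oneSec k X = ((toSheafify (Opens.grothendieckTopology X)
      ((Functor.const _).obj (ModuleCat.of k k) : (Opens X)ᵒᵖ ⥤ ModuleCat.{u} k)).app
        (op ⊤)).hom (1 : k) := by
    simp only [oneSec, constantSheafAdj, Adjunction.comp_unit_app]
    rfl
  have h₂ := (toSheafify (Opens.grothendieckTopology X)
      ((Functor.const _).obj (ModuleCat.of k k) : (Opens X)ᵒᵖ ⥤ ModuleCat.{u} k)).naturality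
        (homOfLE (le_top : W ≤ ⊤)).op
  have h₃ := congrArg (fun φ => ModuleCat.Hom.hom φ (1 : k)) h₂
  rw [h₁]
  refine Eq.trans ?_ (congrArg (fun x => r • x) h₃)
  refine Eq.trans ?_ (map_smul _ _ _)
  exact congrArg _ (mul_one r).symm

lemma exists_smul_oneSec (W : Opens X) (s : Sec (constSheaf k X) W) (x : X) (hx : x ∈ W) :
    ∃ (W' : Opens X) (h : W' ≤ W) (r : k), x ∈ W' ∧
      resSec _ h s = r • resSec (constSheaf k X) le_top (oneSec k X) := by
  let P : (Opens X)ᵒᵖ ⥤ ModuleCat.{u} k := (Functor.const _).obj (ModuleCat.of k k)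
  have H : Presheaf.IsLocallySurjective (Opens.grothendieckTopology X)
    (toSheafify (Opens.grothendieckTopology X) P) := inferInstance
  obtain ⟨V, hV, ⟨r, hr⟩, hxV⟩ := H.imageSieve_mem s x hx
  refine ⟨V, leOfHom hV, r, hxV, hr.symm.trans ?_⟩
  exact toSheafify_const_apply (k := k) V r

lemma eq_zero_of_smul_oneSec (W : Opens X) (x : X) (hx : x ∈ W) (r : k)
    (h : r • resSec (constSheaf k X) (le_top : W ≤ ⊤) (oneSec k X) = 0) : r = 0 := by
  let P : (Opens X)ᵒᵖ ⥤ ModuleCat.{u} k := (Functor.const _).obj (ModuleCat.of k k)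
  have H : Presheaf.IsLocallyInjective (Opens.grothendieckTopology X)
    (toSheafify (Opens.grothendieckTopology X) P) := inferInstance
  have := H.equalizerSieve_mem (X := op W) (r : k) (0 : k)
    ((toSheafify_const_apply W r).trans (h.trans (map_zero _).symm))
  obtain ⟨V, hV, e, hxV⟩ := this x hx
  exact e

/-- Pull-back of sections. -/
def pullSec (f : X ⟶ Y) {F : TopCat.Sheaf (ModuleCat.{u} k) Y} {W : Opens Y} :
    Sec F W →ₗ[k] Sec ((TopCat.Sheaf.pullback (ModuleCat.{u} k) f).obj F) ((Opens.map f).obj W) :=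
  mapSec ((TopCat.Sheaf.pullbackPushforwardAdjunction (ModuleCat.{u} k) f).unit.app F) W

lemma mapSec_pullback_map (f : X ⟶ Y) {F F' : TopCat.Sheaf (ModuleCat.{u} k) Y} (φ : F ⟶ F')
    {W : Opens Y} (s : Sec F W) :
    mapSec ((TopCat.Sheaf.pullback (ModuleCat.{u} k) f).map φ) _ (pullSec f s) =
      pullSec f (mapSec φ W s) := by
  have h := (TopCat.Sheaf.pullbackPushforwardAdjunction (ModuleCat.{u} k) f).unit.naturality φ
  exact (congrArg (fun ψ => mapSec ψ W s) h).symm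

lemma pullSec_resSec (f : X ⟶ Y) {F : TopCat.Sheaf (ModuleCat.{u} k) Y} {W W' : Opens Y}
    (h : W' ≤ W) (s : Sec F W) :
    pullSec f (resSec F h s) = resSec _ ((Opens.map f).monotone h) (pullSec f s) :=
  mapSec_resSec _ h s

/-- Under the adjunction between inverse and direct image, morphisms out of `f⁻¹ A` become morphisms
from `A` to `f_* F`, whose sections over `W` are those of `F` over `f⁻¹ W`. -/
lemma IsUniversalSec.pullSec (f : X ⟶ Y) {A : TopCat.Sheaf (ModuleCat.{u} k) Y} {W : Opens Y}
    {a : Sec A W} (ha : IsUniversalSec a) : IsUniversalSec (pullSec f a) := by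
  intro F
  have h : (fun φ : (TopCat.Sheaf.pullback (ModuleCat.{u} k) f).obj A ⟶ F =>
      mapSec φ _ (EquivCoh.pullSec f a)) =
      (fun ψ : A ⟶ (TopCat.Sheaf.pushforward (ModuleCat.{u} k) f).obj F => mapSec ψ W a) ∘
        (TopCat.Sheaf.pullbackPushforwardAdjunction (ModuleCat.{u} k) f).homEquiv A F := by
    funext φ
    simp only [Function.comp_apply, Adjunction.homEquiv_unit]
    rfl
  rw [h]
  exact (ha _).comp (Equiv.bijective _)

/-- An isomorphism obtained from uniqueness of left adjoints intertwines the two units; evaluate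
them at 1. -/
lemma mapSec_constSheafPullbackIso (f : X ⟶ Y) :
    mapSec (constSheafPullbackIso k f).hom ⊤ (pullSec f (oneSec k Y)) = oneSec k X := by
  have h := Adjunction.homEquiv_leftAdjointUniq_hom_app
    (((constantSheafAdj (Opens.grothendieckTopology Y) (ModuleCat.{u} k)
        (isTerminalTop : IsTerminal (⊤ : Opens Y))).comp
      (TopCat.Sheaf.pullbackPushforwardAdjunction (ModuleCat.{u} k) f)).ofNatIsoRight
        (Iso.refl _ : _ ≅ (sheafSections (Opens.grothendieckTopology X) (ModuleCat.{u} k)).obj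
          (Opposite.op ⊤)))
    (constantSheafAdj (Opens.grothendieckTopology X) (ModuleCat.{u} k)
        (isTerminalTop : IsTerminal (⊤ : Opens X))) (ModuleCat.of k k)
  have h' := congrArg (fun φ => ModuleCat.Hom.hom φ (1 : k)) h
  exact h'

end LocalSections

/-! ### Functoriality of the pull-back in cohomology -/

section PullbackFunctoriality

open Opposite

variable (k : Type u) [CommRing k]

section

variable {X Y Z : TopCat.{u}}

/-- The comparison `(g ∘ f)⁻¹ ⟶ f⁻¹ g⁻¹`. -/
def pullbackCompHom (f : X ⟶ Y) (g : Y ⟶ Z) :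
    TopCat.Sheaf.pullback (ModuleCat.{u} k) (f ≫ g) ⟶
      TopCat.Sheaf.pullback (ModuleCat.{u} k) g ⋙ TopCat.Sheaf.pullback (ModuleCat.{u} k) f :=
  (Adjunction.leftAdjointUniq (TopCat.Sheaf.pullbackPushforwardAdjunction (ModuleCat.{u} k) (f ≫ g))
    (((TopCat.Sheaf.pullbackPushforwardAdjunction (ModuleCat.{u} k) g).comp
      (TopCat.Sheaf.pullbackPushforwardAdjunction (ModuleCat.{u} k) f)).ofNatIsoRight
        (Iso.refl _ : _ ≅ TopCat.Sheaf.pushforward (ModuleCat.{u} k) (f ≫ g)))).hom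

lemma mapSec_pullbackCompHom (f : X ⟶ Y) (g : Y ⟶ Z) {F : TopCat.Sheaf (ModuleCat.{u} k) Z}
    {W : Opens Z} (s : Sec F W) :
    mapSec ((pullbackCompHom k f g).app F) _ (pullSec (f ≫ g) s) = pullSec f (pullSec g s) := by
  have h := Adjunction.homEquiv_leftAdjointUniq_hom_app
    (TopCat.Sheaf.pullbackPushforwardAdjunction (ModuleCat.{u} k) (f ≫ g))
    (((TopCat.Sheaf.pullbackPushforwardAdjunction (ModuleCat.{u} k) g).comp
      (TopCat.Sheaf.pullbackPushforwardAdjunction (ModuleCat.{u} k) f)).ofNatIsoRight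
        (Iso.refl _ : _ ≅ TopCat.Sheaf.pushforward (ModuleCat.{u} k) (f ≫ g))) F
  exact congrArg (fun φ => mapSec φ W s) h

/-- The comparison `id⁻¹ ⟶ id`. -/
def pullbackIdHom (X : TopCat.{u}) :
    TopCat.Sheaf.pullback (ModuleCat.{u} k) (𝟙 X) ⟶ 𝟭 (TopCat.Sheaf (ModuleCat.{u} k) X) :=
  (Adjunction.leftAdjointUniq (TopCat.Sheaf.pullbackPushforwardAdjunction (ModuleCat.{u} k) (𝟙 X))
    (Adjunction.id.ofNatIsoRight
        (Iso.refl _ : _ ≅ TopCat.Sheaf.pushforward (ModuleCat.{u} k) (𝟙 X)))).hom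

lemma mapSec_pullbackIdHom {F : TopCat.Sheaf (ModuleCat.{u} k) X}
    {W : Opens X} (s : Sec F W) :
    mapSec ((pullbackIdHom k X).app F) _ (pullSec (𝟙 X) s) = s := by
  have h := Adjunction.homEquiv_leftAdjointUniq_hom_app
    (TopCat.Sheaf.pullbackPushforwardAdjunction (ModuleCat.{u} k) (𝟙 X))
    (Adjunction.id.ofNatIsoRight
        (Iso.refl _ : _ ≅ TopCat.Sheaf.pushforward (ModuleCat.{u} k) (𝟙 X))) F
  exact congrArg (fun φ => mapSec φ W s) h

/-- The source is generated by the pull-back of the section 1, and both sides send this generator to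
1. -/
lemma pullbackCompHom_constSheafPullbackIso (f : X ⟶ Y) (g : Y ⟶ Z) :
    (pullbackCompHom k f g).app (constSheaf k Z) ≫
      (TopCat.Sheaf.pullback (ModuleCat.{u} k) f).map (constSheafPullbackIso k g).hom ≫
        (constSheafPullbackIso k f).hom = (constSheafPullbackIso k (f ≫ g)).hom := by
  apply ((oneSec_universal (k := k)).pullSec (f ≫ g)).hom_ext
  have h₁ := mapSec_pullbackCompHom k f g (oneSec k Z)
  have h₂ := (mapSec_pullback_map f (constSheafPullbackIso k g).hom (pullSec g (oneSec k Z))).trans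
    (congrArg (pullSec f) (mapSec_constSheafPullbackIso g))
  refine (congrArg (fun s => mapSec (constSheafPullbackIso k f).hom ⊤ (mapSec
    ((TopCat.Sheaf.pullback (ModuleCat.{u} k) f).map (constSheafPullbackIso k g).hom) ⊤ s)) h₁).trans
    ((congrArg (mapSec (constSheafPullbackIso k f).hom ⊤) h₂).trans ?_)
  exact (mapSec_constSheafPullbackIso f).trans (mapSec_constSheafPullbackIso (f ≫ g)).symm

lemma pullbackIdHom_constSheafPullbackIso :
    (pullbackIdHom k X).app (constSheaf k X) = (constSheafPullbackIso k (𝟙 X)).hom := by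
  apply ((oneSec_universal (k := k)).pullSec (𝟙 X)).hom_ext
  exact (mapSec_pullbackIdHom k _).trans (mapSec_constSheafPullbackIso (𝟙 X)).symm

end

lemma mk₀_comp_injective {C : Type*} [Category C] [Abelian C] [HasExt.{u} C] {A B D : C}
    (e : A ≅ B) {n : ℕ} {x y : Ext B D n}
    (h : (Ext.mk₀ e.hom).comp x (zero_add n) = (Ext.mk₀ e.hom).comp y (zero_add n)) : x = y := by
  have := congrArg (fun z => (Ext.mk₀ e.inv).comp z (zero_add n)) h
  simpa using this

lemma mapExactFunctor_of_mk₀_comp {C D : Type*} [Category C] [Abelian C] [HasExt.{u} C]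
    [Category D] [Abelian D] [HasExt.{u} D] (F : C ⥤ D) [F.Additive] [PreservesFiniteLimits F]
    [PreservesFiniteColimits F] {A B A' B' : C} {f : A ⟶ B} {g : A' ⟶ B'} {n : ℕ} {x : Ext B B' n}
    {y : Ext A A' n} (h : (Ext.mk₀ f).comp x (zero_add n) = y.comp (Ext.mk₀ g) (add_zero n)) :
    (Ext.mk₀ (F.map f)).comp (x.mapExactFunctor F) (zero_add n) =
      (y.mapExactFunctor F).comp (Ext.mk₀ (F.map g)) (add_zero n) := by
  rw [← Ext.mapExactFunctor_mk₀, ← Ext.mapExactFunctor_mk₀, ← Ext.mapExactFunctor_comp, h,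
    Ext.mapExactFunctor_comp]

variable {X Y Z : Type u} [TopologicalSpace X] [TopologicalSpace Y] [TopologicalSpace Z]

/-- Clears the inverse from the conjugation defining `f^*`. As composition with an isomorphism is
injective, this equation characterises `f^* x`. -/
lemma mk₀_comp_pullbackDeg (f : C(X, Y)) {n : ℕ} (x : HDeg k Y n) :
    (Ext.mk₀ (constSheafPullbackIso k (TopCat.ofHom f)).hom).comp (pullbackDeg k f n x)
      (zero_add n) =
    (Ext.mapExactFunctor (TopCat.Sheaf.pullback (ModuleCat.{u} k) (TopCat.ofHom f)) x).comp
      (Ext.mk₀ (constSheafPullbackIso k (TopCat.ofHom f)).hom) (add_zero n) := by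
  change (Ext.mk₀ _).comp ((Ext.mk₀ _).comp _ (zero_add n)) (zero_add n) = _
  rw [Ext.mk₀_comp_mk₀_assoc, Iso.hom_inv_id, Ext.mk₀_id_comp]
  rfl

/-- Pasting of squares: naturality of the comparison `(g ∘ f)⁻¹ ⟶ f⁻¹ g⁻¹` (`h₁`), `f⁻¹` of the
square characterising `g^* x` (`h₂`), and the square characterising `f^*` of that class (`h₃`). -/
theorem pullbackDeg_comp (f : C(X, Y)) (g : C(Y, Z)) {n : ℕ} (x : HDeg k Z n) :
    pullbackDeg k (g.comp f) n x = pullbackDeg k f n (pullbackDeg k g n x) := by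
  apply mk₀_comp_injective (constSheafPullbackIso k (TopCat.ofHom (g.comp f)))
  have h : (Ext.mk₀ (constSheafPullbackIso k (TopCat.ofHom (g.comp f))).hom) =
      (Ext.mk₀ ((pullbackCompHom k (TopCat.ofHom f) (TopCat.ofHom g)).app (constSheaf k _))).comp
        ((Ext.mk₀ ((TopCat.Sheaf.pullback (ModuleCat.{u} k) (TopCat.ofHom f)).map
          (constSheafPullbackIso k (TopCat.ofHom g)).hom)).comp
            (Ext.mk₀ (constSheafPullbackIso k (TopCat.ofHom f)).hom) (zero_add 0)) (zero_add 0) := by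
    rw [Ext.mk₀_comp_mk₀, Ext.mk₀_comp_mk₀]
    exact congrArg _ (pullbackCompHom_constSheafPullbackIso k (TopCat.ofHom f) (TopCat.ofHom g)).symm
  have h₁ := mapExactFunctor_comp_naturality
    (pullbackCompHom k (TopCat.ofHom f) (TopCat.ofHom g)) x
  have h₂ := mapExactFunctor_of_mk₀_comp
    (TopCat.Sheaf.pullback (ModuleCat.{u} k) (TopCat.ofHom f)) (mk₀_comp_pullbackDeg k g x)
  have h₃ := mk₀_comp_pullbackDeg k f (pullbackDeg k g n x)
  have h₀ := mk₀_comp_pullbackDeg k (g.comp f) x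
  rw [h₀, h]
  refine Eq.trans ?_ (Ext.comp_assoc _ _ _ (zero_add 0) (zero_add n) (by omega)).symm
  refine Eq.trans ?_ (congrArg (fun z => Ext.comp _ z (zero_add n))
    (Ext.comp_assoc _ _ _ (zero_add 0) (zero_add n) (by omega)).symm)
  refine Eq.trans ?_ (congrArg (fun z => Ext.comp _ (Ext.comp _ z (zero_add n)) (zero_add n)) h₃.symm)
  refine Eq.trans ?_ (congrArg (fun z => Ext.comp _ z (zero_add n))
    ((congrArg (fun z => Ext.comp z _ (add_zero n)) h₂).symm.trans
      (Ext.comp_assoc _ _ _ (zero_add n) (add_zero n) (by omega))))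
  refine Eq.trans ?_ (congrArg (fun z => Ext.comp _ z (zero_add n))
    (Ext.comp_assoc _ _ _ (add_zero n) (add_zero 0) (by omega)).symm)
  refine Eq.trans ?_ (Ext.comp_assoc _ _ _ (zero_add n) (add_zero n) (by omega))
  refine Eq.trans ?_ (congrArg (fun z => Ext.comp z _ (add_zero n)) h₁)
  exact (Ext.comp_assoc _ _ _ (add_zero n) (add_zero 0) (by omega)).symm

theorem pullbackDeg_id {n : ℕ} (x : HDeg k X n) :
    pullbackDeg k (ContinuousMap.id X) n x = x := by
  apply mk₀_comp_injective (constSheafPullbackIso k (TopCat.ofHom (ContinuousMap.id X)))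
  rw [mk₀_comp_pullbackDeg]
  have h' : (constSheafPullbackIso k (TopCat.ofHom (ContinuousMap.id X))).hom = _ :=
    (pullbackIdHom_constSheafPullbackIso k).symm
  rw [h']
  exact mapExactFunctor_id_naturality (pullbackIdHom k (TopCat.of X)) x

end PullbackFunctoriality

/-! ### Local vanishing of classes and higher direct images -/

section LocalVanishing

open Opposite

variable {k : Type u} [CommRing k] {X Y : TopCat.{u}}

/-- The morphism from `freeSheaf k W` determined by a section over `W`. -/
def secHom {F : TopCat.Sheaf (ModuleCat.{u} k) X} {W : Opens X} (s : Sec F W) :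
    freeSheaf k W ⟶ F :=
  (freeSheafEquiv W F).symm s

@[simp] lemma mapSec_secHom {F : TopCat.Sheaf (ModuleCat.{u} k) X} {W : Opens X} (s : Sec F W) :
    mapSec (secHom s) W (gen k W) = s :=
  mapSec_freeSheafEquiv_symm s

lemma secHom_comp {F F' : TopCat.Sheaf (ModuleCat.{u} k) X} {W : Opens X} (s : Sec F W)
    (φ : F ⟶ F') : secHom s ≫ φ = secHom (mapSec φ W s) :=
  (gen_universal W).hom_ext (by simp)

lemma eq_secHom {F : TopCat.Sheaf (ModuleCat.{u} k) X} {W : Opens X} (φ : freeSheaf k W ⟶ F) :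
    φ = secHom (mapSec φ W (gen k W)) :=
  (gen_universal W).hom_ext (by simp)

lemma freeIncl_comp_secHom {F : TopCat.Sheaf (ModuleCat.{u} k) X} {W W' : Opens X} (h : W' ≤ W)
    (s : Sec F W) : freeIncl h ≫ secHom s = secHom (resSec F h s) :=
  (gen_universal W').hom_ext (by simp [mapSec_resSec])

lemma sheafHom_ext {F F' : TopCat.Sheaf (ModuleCat.{u} k) X} {φ ψ : F ⟶ F'}
    (h : ∀ (W : Opens X) (s : Sec F W), mapSec φ W s = mapSec ψ W s) : φ = ψ := by
  apply (sheafToPresheaf _ _).map_injective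
  ext W s
  exact h W.unop s

lemma mk₀_comp_comp_extClass_eq_zero {C : Type*} [Category C] [Abelian C] [HasExt.{u} C]
    {M J Q A N : C} {i : M ⟶ J} {p : J ⟶ Q} {h : i ≫ p = 0}
    (hS : (ShortComplex.mk i p h).ShortExact) (f : N ⟶ A) (g : A ⟶ Q) (t : N ⟶ J)
    (ht : f ≫ g = t ≫ p) :
    (Ext.mk₀ f).comp ((Ext.mk₀ g).comp hS.extClass (zero_add 1)) (zero_add 1) = 0 := by
  have h0 : (Ext.mk₀ p).comp hS.extClass (zero_add 1) = 0 := hS.comp_extClass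
  rw [Ext.mk₀_comp_mk₀_assoc, ht, ← Ext.mk₀_comp_mk₀_assoc, h0, Ext.comp_zero]

/-- Classes of positive degree vanish locally. -/
theorem exists_comp_eq_zero_of_pos {A M : TopCat.Sheaf (ModuleCat.{u} k) X} {W : Opens X}
    (a : Sec A W) {n : ℕ} (x : Ext A M (n + 1)) {y : X} (hy : y ∈ W) :
    ∃ (W' : Opens X) (h : W' ≤ W), y ∈ W' ∧
      (Ext.mk₀ (secHom (resSec A h a))).comp x (zero_add _) = 0 := by
  induction n generalizing M with
  | zero =>
    obtain ⟨J, Q, hJ, i, p, h, hS, z, rfl⟩ := exists_comp_extClass x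
    obtain ⟨g, rfl⟩ := (Ext.mk₀_bijective _ _).2 z
    have hp : Epi p := hS.epi_g
    -- A class of degree one obstructs lifting a section of `Q` to `J`, and such lifts exist
    -- locally.
    obtain ⟨W', hW, hyW, t, ht⟩ := (epi_iff_locally_lift p).1 hp W (mapSec g W a) y hy
    refine ⟨W', hW, hyW, mk₀_comp_comp_extClass_eq_zero hS _ _ (secHom t) ?_⟩
    rw [secHom_comp, secHom_comp, ht, mapSec_resSec]
  | succ n ih =>
    obtain ⟨J, Q, hJ, i, p, h, hS, z, rfl⟩ := exists_comp_extClass x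
    obtain ⟨W', hW, hyW, h0⟩ := ih z
    refine ⟨W', hW, hyW, ?_⟩
    rw [← Ext.comp_assoc _ _ _ (zero_add _) rfl (by omega), h0, Ext.zero_comp]

/-- The higher direct images `Rⁿf_* F`, `n ≥ 1`, vanish: each class of positive degree on
`f⁻¹ U` vanishes locally in `U`. -/
def HigherDirectImagesVanish (f : X ⟶ Y) (F : TopCat.Sheaf (ModuleCat.{u} k) X) : Prop :=
  ∀ (n : ℕ) (U : Opens Y) (y : Y), y ∈ U → ∀ x : Ext (freeSheaf k ((Opens.map f).obj U)) F (n + 1),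
    ∃ (U' : Opens Y) (h : U' ≤ U), y ∈ U' ∧
      (Ext.mk₀ (freeIncl ((Opens.map f).monotone h))).comp x (zero_add _) = 0

/-- This makes the vanishing condition admissible as the predicate in `bijective_ext_of_adjunction`.
The obstruction to lifting a section through `p` is a class of degree one with values in `M`; the
other degrees shift by one along the long exact sequence. -/
lemma HigherDirectImagesVanish.step {f : X ⟶ Y} {M J Q : TopCat.Sheaf (ModuleCat.{u} k) X}
    {i : M ⟶ J} {p : J ⟶ Q} {h : i ≫ p = 0}
    (hS : (ShortComplex.mk i p h).ShortExact) (hJ : Injective J)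
    (hM : HigherDirectImagesVanish f M) :
    Epi ((TopCat.Sheaf.pushforward (ModuleCat.{u} k) f).map p) ∧ HigherDirectImagesVanish f Q := by
  constructor
  · rw [epi_iff_locally_lift]
    intro U (s : Sec Q ((Opens.map f).obj U)) y hy
    obtain ⟨U', hU, hyU, h0⟩ := hM 0 U y hy
      ((Ext.mk₀ (secHom s)).comp hS.extClass (zero_add 1))
    rw [Ext.mk₀_comp_mk₀_assoc] at h0
    obtain ⟨w, hw⟩ := Ext.covariant_sequence_exact₃ _ hS _ _ h0
    obtain ⟨t, rfl⟩ := (Ext.mk₀_bijective _ _).2 w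
    rw [Ext.mk₀_comp_mk₀] at hw
    have hw' := (Ext.mk₀_bijective _ _).1 hw
    refine ⟨U', hU, hyU, mapSec t _ (gen k _), ?_⟩
    have := congrArg (fun φ => mapSec φ _ (gen k _)) hw'
    dsimp only at this
    rw [freeIncl_comp_secHom, mapSec_secHom, mapSec_comp] at this
    exact this
  · intro n U y hy x
    obtain ⟨U', hU, hyU, h0⟩ := hM (n + 1) U y hy (x.comp hS.extClass rfl)
    refine ⟨U', hU, hyU, ?_⟩
    rw [← Ext.comp_assoc _ _ _ (zero_add _) rfl (by omega)] at h0
    obtain ⟨w, hw⟩ := Ext.covariant_sequence_exact₃ _ hS _ _ h0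
    rw [← hw, Ext.eq_zero_of_injective w, Ext.zero_comp]

end LocalVanishing

/-! ### A criterion for cohomology isomorphisms -/

section DirectImage

open Opposite

variable {k : Type u} [CommRing k]

/-- Sections of the constant sheaf over `f⁻¹ U` are constant locally in `U`. -/
def LocallyConstantSectionsDescend (k : Type u) [CommRing k] {X Y : TopCat.{u}} (f : X ⟶ Y) :
    Prop :=
  ∀ (U : Opens Y) (s : Sec (constSheaf k X) ((Opens.map f).obj U)), ∀ y ∈ U,
    ∃ (U' : Opens Y) (h : U' ≤ U) (r : k), y ∈ U' ∧
      resSec _ ((Opens.map f).monotone h) s = r • resSec (constSheaf k X) le_top (oneSec k X)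

/-- The canonical morphism `k_Y ⟶ f_* k_X`. -/
def toPushforward (k : Type u) [CommRing k] {X Y : TopCat.{u}} (f : X ⟶ Y) :
    constSheaf k Y ⟶ (TopCat.Sheaf.pushforward (ModuleCat.{u} k) f).obj (constSheaf k X) :=
  (TopCat.Sheaf.pullbackPushforwardAdjunction (ModuleCat.{u} k) f).homEquiv _ _
    (constSheafPullbackIso k f).hom

lemma map_toPushforward_comp_counit {X Y : TopCat.{u}} (f : X ⟶ Y) :
    (TopCat.Sheaf.pullback (ModuleCat.{u} k) f).map (toPushforward k f) ≫
      (TopCat.Sheaf.pullbackPushforwardAdjunction (ModuleCat.{u} k) f).counit.app _ =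
        (constSheafPullbackIso k f).hom :=
  ((TopCat.Sheaf.pullbackPushforwardAdjunction (ModuleCat.{u} k) f).homEquiv_counit _ _ _).symm.trans
    (Equiv.symm_apply_apply _ _)

lemma mapSec_toPushforward {X Y : TopCat.{u}} (f : X ⟶ Y) :
    mapSec (toPushforward k f) ⊤ (oneSec k Y) = oneSec k X := by
  rw [toPushforward, Adjunction.homEquiv_unit]
  exact mapSec_constSheafPullbackIso f

lemma mapSec_toPushforward_smul {X Y : TopCat.{u}} (f : X ⟶ Y) (U : Opens Y) (r : k) :
    mapSec (toPushforward k f) U (r • resSec (constSheaf k Y) le_top (oneSec k Y)) =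
      r • resSec (constSheaf k X) (le_top : (Opens.map f).obj U ≤ ⊤) (oneSec k X) := by
  rw [map_smul, mapSec_resSec, mapSec_toPushforward]
  rfl

/-- Sections of `k_Y` are locally constants `r`. If `r` dies on `f⁻¹ W'`, then `r = 0`, since by
surjectivity this set contains a point over the given `y`. The descent hypothesis is exactly local
surjectivity. -/
lemma isIso_toPushforward {X Y : TopCat.{u}} (f : X ⟶ Y) (hf : Function.Surjective f)
    (h : LocallyConstantSectionsDescend k f) : IsIso (toPushforward k f) := by
  have : Mono (toPushforward k f) := by
    refine Preadditive.mono_of_cancel_zero _ fun {N} g hg => sheafHom_ext fun W s => ?_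
    have h0 : mapSec (toPushforward k f) W (mapSec g W s) = 0 :=
      congrArg (fun φ => mapSec φ W s) hg
    refine resSec_eq_of_cover _ _ _ fun y hy => ?_
    obtain ⟨W', hW, r, hyW, hr⟩ := exists_smul_oneSec W (mapSec g W s) y hy
    refine ⟨W', hW, hyW, ?_⟩
    have h1 := congrArg (resSec _ hW) h0
    rw [← mapSec_resSec, hr, mapSec_toPushforward_smul, map_zero] at h1
    obtain ⟨x, rfl⟩ := hf y
    have h2 := eq_zero_of_smul_oneSec _ x hyW r h1
    rw [hr, h2, zero_smul]
    exact (map_zero _).symm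
  have : Epi (toPushforward k f) := by
    rw [epi_iff_locally_lift]
    intro U s y hy
    obtain ⟨U', hU, r, hyU, hr⟩ := h U s y hy
    exact ⟨U', hU, hyU, _, (mapSec_toPushforward_smul f U' r).trans hr.symm⟩
  exact isIso_of_mono_of_epi _

/-- If `k_Y = f_* k_X` and the higher direct images of `k_X` vanish, then `f` induces isomorphisms
in cohomology. -/
theorem pullbackDeg_bijective {X Y : Type u} [TopologicalSpace X] [TopologicalSpace Y] (f : C(X, Y))
    (hf : Function.Surjective f) (h₀ : LocallyConstantSectionsDescend k (TopCat.ofHom f))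
    (h : HigherDirectImagesVanish (TopCat.ofHom f) (constSheaf k (TopCat.of X))) (n : ℕ) :
    Function.Bijective (pullbackDeg k f n) := by
  have hiso := isIso_toPushforward (k := k) (TopCat.ofHom f) hf h₀
  have hadj := bijective_ext_of_adjunction
    (TopCat.Sheaf.pullbackPushforwardAdjunction (ModuleCat.{u} k) (TopCat.ofHom f))
    (HigherDirectImagesVanish (TopCat.ofHom f)) (fun _ _ _ _ _ _ hS hJ hM => hM.step hS hJ)
    (constSheaf k (TopCat.of Y)) h n
  have hpost : Function.Bijective (fun x : Ext (constSheaf k (TopCat.of Y)) (constSheaf k _) n =>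
      x.comp (Ext.mk₀ (toPushforward k (TopCat.ofHom f))) (add_zero n)) := by
    refine Function.bijective_iff_has_inverse.2
      ⟨fun x => x.comp (Ext.mk₀ (inv (toPushforward k (TopCat.ofHom f)))) (add_zero n), ?_, ?_⟩
    · intro x
      simp
    · intro x
      simp
  have hpre : Function.Bijective
      (fun x : Ext (constSheaf k (TopCat.of X)) (constSheaf k (TopCat.of X)) n =>
      (Ext.mk₀ (constSheafPullbackIso k (TopCat.ofHom f)).hom).comp x (zero_add n)) := by
    refine ⟨fun x y hxy => mk₀_comp_injective _ hxy, fun x =>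
      ⟨(Ext.mk₀ (constSheafPullbackIso k (TopCat.ofHom f)).inv).comp x (zero_add n), ?_⟩⟩
    simp
  -- `toPushforward` is the transpose of `f⁻¹ k_Y ≅ k_X`, so composing with it and then applying the
  -- adjunction bijection is `f⁻¹` followed by this isomorphism. Up to the bijection `hpre`, that is
  -- `f^*`.
  have hcomp : ∀ x : Ext (constSheaf k (TopCat.of Y)) (constSheaf k (TopCat.of Y)) n,
      (Ext.mapExactFunctor (TopCat.Sheaf.pullback (ModuleCat.{u} k) (TopCat.ofHom f))
        (x.comp (Ext.mk₀ (toPushforward k (TopCat.ofHom f))) (add_zero n))).comp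
        (Ext.mk₀ ((TopCat.Sheaf.pullbackPushforwardAdjunction (ModuleCat.{u} k)
          (TopCat.ofHom f)).counit.app _)) (add_zero n) =
      (Ext.mapExactFunctor (TopCat.Sheaf.pullback (ModuleCat.{u} k) (TopCat.ofHom f)) x).comp
        (Ext.mk₀ (constSheafPullbackIso k (TopCat.ofHom f)).hom) (add_zero n) := by
    intro x
    rw [Ext.mapExactFunctor_comp, Ext.mapExactFunctor_mk₀, Ext.comp_assoc_of_third_deg_zero,
      Ext.mk₀_comp_mk₀]
    exact congrArg (fun z => Ext.comp _ (Ext.mk₀ z) _) (map_toPushforward_comp_counit _)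
  refine (Function.Bijective.of_comp_iff' hpre (pullbackDeg k f n)).1 ?_
  refine (congrArg Function.Bijective (funext fun x => ?_)).mpr (hadj.comp hpost)
  exact (mk₀_comp_pullbackDeg k f x).trans (hcomp x).symm

end DirectImage

/-! ### Extension by zero and excision for open embeddings -/

section Excision

open Opposite Topology

variable {k : Type u} [CommRing k] {V Y : TopCat.{u}} (j : V ⟶ Y)

lemma presheaf_map_map (T : Y.Presheaf (ModuleCat.{u} k)) {A B C : (Opens Y)ᵒᵖ} (f : A ⟶ B)
    (g : B ⟶ C) (h : A ⟶ C) (x : T.obj A) :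
    (T.map g).hom ((T.map f).hom x) = (T.map h).hom x := by
  rw [Subsingleton.elim h (f ≫ g), T.map_comp]
  rfl

lemma presheaf_map_self (T : Y.Presheaf (ModuleCat.{u} k)) {A : (Opens Y)ᵒᵖ} (f : A ⟶ A)
    (x : T.obj A) : (T.map f).hom x = x := by
  rw [Subsingleton.elim f (𝟙 A), T.map_id]
  rfl

/-- The sections over `W` of the extension by zero of a presheaf along an open embedding. -/
def extZeroSubmodule (P : V.Presheaf (ModuleCat.{u} k)) (W : Opens Y) :
    Submodule k (P.obj (op ((Opens.map j).obj W))) where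
  carrier := {s | ¬ ((W : Set Y) ⊆ Set.range j) → s = 0}
  add_mem' ha hb h := by rw [ha h, hb h, add_zero]
  zero_mem' _ := rfl
  smul_mem' r s hs h := by rw [hs h, smul_zero]

/-- The extension by zero of a presheaf along an open embedding. -/
def extZero (P : V.Presheaf (ModuleCat.{u} k)) : Y.Presheaf (ModuleCat.{u} k) where
  obj W := ModuleCat.of k (extZeroSubmodule j P W.unop)
  map {W W'} i := ModuleCat.ofHom
    (((P.map ((Opens.map j).map i.unop).op).hom.comp (Submodule.subtype _)).codRestrict _
      (fun s hW' => by
        have := s.2 (fun hW => hW' (Set.Subset.trans (leOfHom i.unop) hW))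
        change (P.map _).hom s.1 = 0
        rw [this, map_zero]))
  map_id W := by
    ext s
    exact congrArg (fun φ => ModuleCat.Hom.hom φ s.1) (P.map_id _)
  map_comp f g := by
    ext s
    exact congrArg (fun φ => ModuleCat.Hom.hom φ s.1) (P.map_comp ((Opens.map j).map f.unop).op
      ((Opens.map j).map g.unop).op)

/-- The functoriality of the extension by zero. -/
def extZeroMap {P P' : V.Presheaf (ModuleCat.{u} k)} (φ : P ⟶ P') :
    extZero j P ⟶ extZero j P' where
  app W := ModuleCat.ofHom
    (((φ.app (op ((Opens.map j).obj W.unop))).hom.comp (Submodule.subtype _)).codRestrict _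
      (fun s hW => by
        have := s.2 hW
        change (φ.app _).hom s.1 = 0
        rw [this, map_zero]))
  naturality W W' i := by
    ext s
    apply Subtype.ext
    exact congrArg (fun ψ => ModuleCat.Hom.hom ψ s.1) (φ.naturality ((Opens.map j).map i.unop).op)

lemma extZeroMap_mono {P P' : V.Presheaf (ModuleCat.{u} k)} (φ : P ⟶ P') [Mono φ] :
    Mono (extZeroMap j φ) := by
  have : ∀ W, Mono ((extZeroMap j φ).app W) := by
    intro W
    rw [ModuleCat.mono_iff_injective]
    intro s t h
    apply Subtype.ext
    exact (ModuleCat.mono_iff_injective (φ.app (op ((Opens.map j).obj W.unop)))).1 inferInstance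
      (congrArg Subtype.val h)
  exact NatTrans.mono_of_mono_app _

variable {j} (hj : IsOpenEmbedding j)

lemma map_obj_functor_obj_le (U : Opens V) : (Opens.map j).obj (hj.functor.obj U) ≤ U := by
  rintro x ⟨y, hy, hyx⟩
  exact hj.injective hyx ▸ hy

lemma le_functor_obj_map_obj {W : Opens Y} (hW : (W : Set Y) ⊆ Set.range j) :
    W ≤ hj.functor.obj ((Opens.map j).obj W) := by
  intro y hy
  obtain ⟨x, rfl⟩ := hW hy
  exact ⟨x, hy, rfl⟩

lemma functor_obj_map_obj_le (W : Opens Y) : hj.functor.obj ((Opens.map j).obj W) ≤ W := by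
  rintro _ ⟨x, hx, rfl⟩
  exact hx

/-- The unit of the adjunction between extension by zero and restriction of presheaves. -/
def extZeroUnit (P : V.Presheaf (ModuleCat.{u} k)) : P ⟶ hj.functor.op ⋙ extZero j P where
  app U := ModuleCat.ofHom ((P.map (homOfLE (map_obj_functor_obj_le hj U.unop)).op).hom.codRestrict _
    (fun s hW => by
      refine absurd ?_ hW
      rintro _ ⟨x, -, rfl⟩
      exact ⟨x, rfl⟩))
  naturality U U' i := by
    ext s
    apply Subtype.ext
    change (P.map _).hom ((P.map _).hom s) = (P.map _).hom ((P.map _).hom s)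
    exact (presheaf_map_map P _ _ (homOfLE ((map_obj_functor_obj_le hj U'.unop).trans
      (leOfHom i.unop))).op _).trans (presheaf_map_map P _ _ _ _).symm

open Classical in
/-- The morphism out of the extension by zero determined by a morphism to a restriction. -/
def extZeroDesc {P : V.Presheaf (ModuleCat.{u} k)} {T : Y.Presheaf (ModuleCat.{u} k)}
    (g : P ⟶ hj.functor.op ⋙ T) : extZero j P ⟶ T where
  app W := ModuleCat.ofHom (if h : (W.unop : Set Y) ⊆ Set.range j then
    ((T.map (homOfLE (le_functor_obj_map_obj hj h)).op).hom.comp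
      (g.app (op ((Opens.map j).obj W.unop))).hom).comp (Submodule.subtype _) else 0)
  naturality W W' i := by
    ext s
    by_cases h : (W.unop : Set Y) ⊆ Set.range j
    · have h' : (W'.unop : Set Y) ⊆ Set.range j := Set.Subset.trans (leOfHom i.unop) h
      simp only [dif_pos h, dif_pos h']
      have := congrArg (fun ψ => ModuleCat.Hom.hom ψ s.1) (g.naturality ((Opens.map j).map i.unop).op)
      change (T.map _).hom ((g.app _).hom ((P.map _).hom s.1)) =
        (T.map _).hom ((T.map _).hom ((g.app _).hom s.1))
      refine (congrArg (T.map _).hom this).trans ?_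
      change (T.map _).hom ((T.map _).hom ((g.app _).hom s.1)) = _
      exact (presheaf_map_map T _ _ (homOfLE (Set.Subset.trans (leOfHom i.unop)
        (le_functor_obj_map_obj hj h))).op _).trans (presheaf_map_map T _ _ _ _).symm
    · have hs : s = 0 := Subtype.ext (s.2 h)
      rw [hs, map_zero, map_zero]

lemma extZeroUnit_desc {P : V.Presheaf (ModuleCat.{u} k)} {T : Y.Presheaf (ModuleCat.{u} k)}
    (g : P ⟶ hj.functor.op ⋙ T) :
    extZeroUnit hj P ≫ Functor.whiskerLeft hj.functor.op (extZeroDesc hj g) = g := by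
  refine NatTrans.ext (funext fun U => ModuleCat.hom_ext (LinearMap.ext fun s => ?_))
  have h : ((hj.functor.obj U.unop : Opens Y) : Set Y) ⊆ Set.range j := by
    rintro _ ⟨x, -, rfl⟩
    exact ⟨x, rfl⟩
  have := congrArg (fun ψ => ModuleCat.Hom.hom ψ s)
    (g.naturality (homOfLE (map_obj_functor_obj_le hj U.unop)).op)
  change ((extZeroDesc hj g).app (op (hj.functor.obj U.unop))).hom _ = _
  simp only [extZeroDesc]
  rw [dif_pos h]
  change (T.map _).hom ((g.app _).hom ((P.map _).hom s)) = _
  refine (congrArg (T.map _).hom this).trans ?_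
  change (T.map _).hom ((T.map _).hom ((g.app _).hom s)) = _
  exact (presheaf_map_map T _ _ (𝟙 _) _).trans (presheaf_map_self T _ _)

lemma extZeroUnit_naturality {P P' : V.Presheaf (ModuleCat.{u} k)} (φ : P ⟶ P') :
    φ ≫ extZeroUnit hj P' =
      extZeroUnit hj P ≫ Functor.whiskerLeft hj.functor.op (extZeroMap j φ) := by
  refine NatTrans.ext (funext fun U => ModuleCat.hom_ext (LinearMap.ext fun s => ?_))
  apply Subtype.ext
  exact (congrArg (fun ψ => ModuleCat.Hom.hom ψ s)
    (φ.naturality (homOfLE (map_obj_functor_obj_le hj U.unop)).op)).symm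

/-- The restriction of an injective sheaf along an open embedding is injective. -/
lemma injective_sheafPullback (J : TopCat.Sheaf (ModuleCat.{u} k) Y) [Injective J] :
    Injective ((hj.sheafPullback (ModuleCat.{u} k)).obj J) where
  factors {M N} g i hi := by
    have hi' : Mono i.hom := by
      have : ∀ W, Mono (i.hom.app W) := fun W =>
        (ModuleCat.mono_iff_injective _).2 (mapSec_injective i W.unop)
      exact NatTrans.mono_of_mono_app _
    have := extZeroMap_mono j i.hom
    let E (P : V.Presheaf (ModuleCat.{u} k)) : TopCat.Sheaf (ModuleCat.{u} k) Y :=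
      (presheafToSheaf (Opens.grothendieckTopology Y) (ModuleCat.{u} k)).obj (extZero j P)
    let f : E M.obj ⟶ E N.obj :=
      (presheafToSheaf (Opens.grothendieckTopology Y) (ModuleCat.{u} k)).map (extZeroMap j i.hom)
    have hm : Mono f := Functor.map_mono (presheafToSheaf _ _) (extZeroMap j i.hom)
    let adj := sheafificationAdjunction (Opens.grothendieckTopology Y) (ModuleCat.{u} k)
    -- The transpose of `g` under extension by zero. Injectivity of `J` extends it along `f`, and
    -- transposing back gives the required extension of `g`.
    let G : E M.obj ⟶ J := (adj.homEquiv (extZero j M.obj) J).symm (extZeroDesc hj g.hom)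
    obtain ⟨φ, hφ⟩ := Injective.factors G f
    let φ' := adj.homEquiv (extZero j N.obj) J φ
    have h₁ : extZeroMap j i.hom ≫ φ' = extZeroDesc hj g.hom := by
      refine (adj.homEquiv_naturality_left _ _).symm.trans ?_
      exact (congrArg (adj.homEquiv (extZero j M.obj) J) hφ).trans (Equiv.apply_symm_apply _ _)
    refine ⟨⟨extZeroUnit hj N.obj ≫ Functor.whiskerLeft hj.functor.op φ'⟩, ?_⟩
    apply (sheafToPresheaf _ _).map_injective
    change i.hom ≫ extZeroUnit hj N.obj ≫ Functor.whiskerLeft hj.functor.op φ' = g.hom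
    rw [← Category.assoc, extZeroUnit_naturality, Category.assoc, ← Functor.whiskerLeft_comp, h₁]
    exact extZeroUnit_desc hj g.hom

/-- For an open embedding, the restriction functor is isomorphic to the inverse image functor. -/
def pullbackIsoOfIsOpenEmbedding : TopCat.Sheaf.pullback (ModuleCat.{u} k) j ≅
    hj.sheafPullback (ModuleCat.{u} k) :=
  haveI := hj.functor_isContinuous
  Adjunction.leftAdjointUniq (TopCat.Sheaf.pullbackPushforwardAdjunction (ModuleCat.{u} k) j)
    (hj.isOpenMap.adjunction.sheafPushforwardContinuous
      (Opens.grothendieckTopology V) (Opens.grothendieckTopology Y))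

lemma mapSec_pullbackIsoOfIsOpenEmbedding {M : TopCat.Sheaf (ModuleCat.{u} k) Y} {W : Opens Y}
    (s : Sec M W) :
    mapSec ((pullbackIsoOfIsOpenEmbedding hj).hom.app M) _ (pullSec j s) =
      resSec M (functor_obj_map_obj_le hj W) s := by
  have := hj.functor_isContinuous
  have h := Adjunction.homEquiv_leftAdjointUniq_hom_app
    (TopCat.Sheaf.pullbackPushforwardAdjunction (ModuleCat.{u} k) j)
    (hj.isOpenMap.adjunction.sheafPushforwardContinuous
      (Opens.grothendieckTopology V) (Opens.grothendieckTopology Y)) M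
  exact congrArg (fun φ => mapSec φ W s) h

include hj in
-- After identifying `j⁻¹` with restriction, pull-back of sections becomes restriction from `W` to
-- `j (j⁻¹ W)`, which is `W` itself.
lemma pullSec_bijective {M : TopCat.Sheaf (ModuleCat.{u} k) Y} {W : Opens Y}
    (hW : (W : Set Y) ⊆ Set.range j) : Function.Bijective (pullSec j : Sec M W →ₗ[k] _) := by
  let e := (pullbackIsoOfIsOpenEmbedding (k := k) hj).app M
  have h₁ : Function.Bijective (mapSec e.hom ((Opens.map j).obj W)) := by
    refine Function.bijective_iff_has_inverse.2 ⟨mapSec e.inv _, fun s => ?_, fun s => ?_⟩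
    · rw [← mapSec_comp, e.hom_inv_id]; rfl
    · rw [← mapSec_comp, e.inv_hom_id]; rfl
  rw [← Function.Bijective.of_comp_iff' h₁]
  have h₂ : mapSec e.hom ((Opens.map j).obj W) ∘ (pullSec j : Sec M W →ₗ[k] _) =
      resSec M (functor_obj_map_obj_le hj W) :=
    funext fun s => mapSec_pullbackIsoOfIsOpenEmbedding hj s
  rw [h₂]
  refine Function.bijective_iff_has_inverse.2
    ⟨resSec M (le_functor_obj_map_obj hj hW), fun s => ?_, fun s => ?_⟩
  · exact (resSec_resSec M _ _ s).trans (resSec_self M le_rfl s)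
  · exact (resSec_resSec M _ _ s).trans (resSec_self M le_rfl s)

include hj in
lemma injective_pullback (J : TopCat.Sheaf (ModuleCat.{u} k) Y) [Injective J] :
    Injective ((TopCat.Sheaf.pullback (ModuleCat.{u} k) j).obj J) :=
  have := injective_sheafPullback hj J
  Injective.of_iso ((pullbackIsoOfIsOpenEmbedding hj).app J).symm this

include hj in
-- Both sets of morphisms are sets of sections, related by `pullSec`. This is the degree 0 part of
-- excision.
lemma pullback_map_bijective {W : Opens Y} (hW : (W : Set Y) ⊆ Set.range j)
    (M : TopCat.Sheaf (ModuleCat.{u} k) Y) :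
    Function.Bijective (fun φ : freeSheaf k W ⟶ M =>
      (TopCat.Sheaf.pullback (ModuleCat.{u} k) j).map φ) := by
  rw [← Function.Bijective.of_comp_iff' ((gen_universal (k := k) W).pullSec j _)]
  have : (fun φ => mapSec φ _ (pullSec j (gen k W))) ∘ (fun φ : freeSheaf k W ⟶ M =>
      (TopCat.Sheaf.pullback (ModuleCat.{u} k) j).map φ) =
        pullSec j ∘ fun φ => mapSec φ _ (gen k W) :=
    funext fun φ => mapSec_pullback_map j φ _
  rw [this]
  exact (pullSec_bijective hj hW).comp (gen_universal W M)

include hj in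
/-- Excision: cohomology classes over an open set `W` are detected on `W`. -/
theorem eq_zero_of_mapExactFunctor_pullback_eq_zero {W : Opens Y} (hW : (W : Set Y) ⊆ Set.range j)
    {M : TopCat.Sheaf (ModuleCat.{u} k) Y} {n : ℕ} (x : Ext (freeSheaf k W) M n)
    (hx : x.mapExactFunctor (TopCat.Sheaf.pullback (ModuleCat.{u} k) j) = 0) : x = 0 := by
  induction n generalizing M with
  | zero =>
    obtain ⟨f, rfl⟩ := (Ext.mk₀_bijective _ _).2 x
    rw [Ext.mapExactFunctor_mk₀, Ext.mk₀_eq_zero_iff] at hx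
    rw [Ext.mk₀_eq_zero_iff]
    apply (pullback_map_bijective hj hW M).1
    exact hx.trans (Functor.map_zero _ _ _).symm
  | succ n ih =>
    obtain ⟨J, Q, hJ, i, p, h, hS, z, rfl⟩ := exists_comp_extClass x
    obtain ⟨h', hS'⟩ := shortExact_map_mk (TopCat.Sheaf.pullback (ModuleCat.{u} k) j) hS
    rw [Ext.mapExactFunctor_comp, mapExactFunctor_extClass_mk _ hS hS'] at hx
    obtain ⟨w, hw⟩ := Ext.covariant_sequence_exact₃ _ hS' _ _ hx
    -- If `w` has degree 0, it descends to `Y` by `pullback_map_bijective`; in positive degree it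
    -- vanishes since `j⁻¹ J` is still injective.
    cases n with
    | zero =>
      obtain ⟨t, rfl⟩ := (Ext.mk₀_bijective _ _).2 w
      obtain ⟨z, rfl⟩ := (Ext.mk₀_bijective _ _).2 z
      obtain ⟨t, rfl⟩ := (pullback_map_bijective hj hW J).2 t
      dsimp only at hw
      rw [Ext.mk₀_comp_mk₀, Ext.mapExactFunctor_mk₀] at hw
      have hw' := (Ext.mk₀_bijective _ _).1 hw
      rw [← Functor.map_comp] at hw'
      rw [← (pullback_map_bijective hj hW Q).1 hw', ← Ext.mk₀_comp_mk₀,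
        Ext.comp_assoc_of_second_deg_zero]
      have h0 : (Ext.mk₀ p).comp hS.extClass (zero_add 1) = 0 := hS.comp_extClass
      rw [h0, Ext.comp_zero]
    | succ n =>
      have := injective_pullback hj J
      rw [Ext.eq_zero_of_injective w, Ext.zero_comp] at hw
      rw [ih z hw.symm, Ext.zero_comp]

end Excision

/-! ### Fibre bundles and direct images of constant sheaves -/

section LocallyTrivial

open Opposite Topology

variable {B Y : Type*} [TopologicalSpace B] [TopologicalSpace Y]

/-- A trivialisation of `p : Y → B` with fibre `F` over an open set `U`, as an open embedding of
`U × F` onto `p⁻¹ U`. -/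
structure IsTrivialization (p : Y → B) {F : Type*} [TopologicalSpace F] (U : Opens B)
    (j : U × F → Y) : Prop where
  isOpenEmbedding : IsOpenEmbedding j
  range_eq : Set.range j = p ⁻¹' U
  proj (z : U × F) : p (j z) = z.1

/-- A fibre bundle with fibre `F`. -/
def IsFibreBundle (p : Y → B) (F : Type*) [TopologicalSpace F] : Prop :=
  ∀ b : B, ∃ (U : Opens B) (j : U × F → Y), b ∈ U ∧ IsTrivialization p U j

lemma IsTrivialization.restrict {p : Y → B} {F : Type*} [TopologicalSpace F] {U : Opens B}
    {j : U × F → Y} (h : IsTrivialization p U j) {U' : Opens B} (hU : U' ≤ U) :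
    IsTrivialization p U' (j ∘ Prod.map (Set.inclusion hU) id) where
  isOpenEmbedding := h.isOpenEmbedding.comp
    ((IsOpenEmbedding.inclusion hU (U'.2.preimage continuous_subtype_val)).prodMap .id)
  range_eq := by
    apply Set.Subset.antisymm
    · rintro _ ⟨z, rfl⟩
      change p (j _) ∈ U'
      rw [h.proj]
      exact z.1.2
    · intro y hy
      have hy' : y ∈ Set.range j := by
        rw [h.range_eq]
        exact hU hy
      obtain ⟨⟨u, f⟩, rfl⟩ := hy'
      refine ⟨(⟨u, ?_⟩, f), rfl⟩
      have := h.proj (u, f)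
      change p (j (u, f)) ∈ U' at hy
      rwa [this] at hy
  proj z := h.proj _

lemma IsFibreBundle.exists_le {p : Y → B} {F : Type*} [TopologicalSpace F]
    (h : IsFibreBundle p F) (U : Opens B) {b : B} (hb : b ∈ U) :
    ∃ (U' : Opens B) (j : U' × F → Y), U' ≤ U ∧ b ∈ U' ∧ IsTrivialization p U' j := by
  obtain ⟨U₀, j, hb₀, hj⟩ := h b
  exact ⟨U₀ ⊓ U, _, inf_le_right, ⟨hb₀, hb⟩, hj.restrict inf_le_left⟩

lemma IsFibreBundle.surjective {p : Y → B} {F : Type*} [TopologicalSpace F] [Nonempty F]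
    (h : IsFibreBundle p F) : Function.Surjective p := by
  intro b
  obtain ⟨U, j, hb, hj⟩ := h b
  exact ⟨j (⟨b, hb⟩, Classical.arbitrary F), hj.proj _⟩

/-- In a trivialisation, the local values of `s` form a locally constant function `r` on `U₁ × F`.
Connectedness of `F` makes it depend on the base point only, and it is then locally constant on the
base. -/
theorem IsFibreBundle.locallyConstantSectionsDescend {k : Type u} [CommRing k] {B Y : Type u}
    [TopologicalSpace B] [TopologicalSpace Y] {p : C(Y, B)} {F : Type*}
    [TopologicalSpace F] [ConnectedSpace F] (h : IsFibreBundle p F) :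
    LocallyConstantSectionsDescend k (TopCat.ofHom p) := by
  intro U s b hb
  obtain ⟨U₁, j, hU₁, hb₁, hj⟩ := h.exists_le U hb
  have hmem : ∀ z : U₁ × F, j z ∈ (Opens.map (TopCat.ofHom p)).obj U := fun z => by
    change p (j z) ∈ U
    rw [hj.proj]
    exact hU₁ z.1.2
  have hloc : ∀ z : U₁ × F, ∃ (W : Opens (TopCat.of Y))
      (h : W ≤ (Opens.map (TopCat.ofHom p)).obj U) (r : k), j z ∈ W ∧
      resSec _ h s = r • resSec (constSheaf k _) le_top (oneSec k _) := fun z =>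
    exists_smul_oneSec _ s (j z) (hmem z)
  choose W hW r hzW hr using hloc
  have hlc : IsLocallyConstant r := by
    rw [IsLocallyConstant.iff_exists_open]
    intro z
    refine ⟨j ⁻¹' W z, (W z).2.preimage hj.isOpenEmbedding.continuous, hzW z, fun z' hz' => ?_⟩
    have e₁ := congrArg (resSec _ (inf_le_left : W z ⊓ W z' ≤ W z)) (hr z)
    have e₂ := congrArg (resSec _ (inf_le_right : W z ⊓ W z' ≤ W z')) (hr z')
    rw [resSec_resSec, map_smul, resSec_resSec] at e₁ e₂
    rw [← sub_eq_zero]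
    -- Both constants represent `s` on this intersection, which is nonempty since it contains `j
    -- z'`.
    refine eq_zero_of_smul_oneSec (W z ⊓ W z') (j z') ⟨hz', hzW z'⟩ _ ?_
    rw [sub_smul, ← e₁, ← e₂, sub_self]
  have f₀ : F := Classical.arbitrary F
  have hfib : ∀ (u : U₁) (f : F), r (u, f) = r (u, f₀) := fun u f =>
    (hlc.comp_continuous (Continuous.prodMk_right u)).apply_eq_of_preconnectedSpace f f₀
  have hlc₀ : IsLocallyConstant fun u => r (u, f₀) :=
    hlc.comp_continuous (Continuous.prodMk_left f₀)
  let b₁ : U₁ := ⟨b, hb₁⟩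
  let U' : Opens B := ⟨Subtype.val '' {u : U₁ | r (u, f₀) = r (b₁, f₀)},
    U₁.2.isOpenMap_subtype_val _ (hlc₀ {r (b₁, f₀)})⟩
  have hU' : U' ≤ U := by
    rintro _ ⟨u, -, rfl⟩
    exact hU₁ u.2
  refine ⟨U', hU', r (b₁, f₀), ⟨b₁, rfl, rfl⟩, resSec_eq_of_cover _ _ _ fun y hy => ?_⟩
  obtain ⟨u, hu, huy⟩ := hy
  have hy : y ∈ Set.range j := by
    rw [hj.range_eq]
    change p y ∈ U₁
    have hu' : (u : B) = p y := huy
    exact hu' ▸ u.2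
  obtain ⟨⟨u', f⟩, rfl⟩ := hy
  obtain rfl : u' = u := Subtype.ext ((hj.proj _).symm.trans huy.symm)
  refine ⟨(Opens.map (TopCat.ofHom p)).obj U' ⊓ W (u', f), inf_le_left,
    ⟨⟨u', hu, huy⟩, hzW _⟩, ?_⟩
  have e := congrArg (resSec _ (inf_le_right :
    (Opens.map (TopCat.ofHom p)).obj U' ⊓ W (u', f) ≤ W (u', f))) (hr (u', f))
  rw [resSec_resSec, map_smul, resSec_resSec, hfib, hu] at e
  rw [resSec_resSec, e, map_smul, resSec_resSec]

lemma isFibreBundle_fst (B : Type*) [TopologicalSpace B] (F : Type*) [TopologicalSpace F] :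
    IsFibreBundle (Prod.fst : B × F → B) F := fun b =>
  ⟨⊤, Prod.map Subtype.val id, trivial,
    { isOpenEmbedding := (isOpen_univ.isOpenEmbedding_subtypeVal).prodMap .id
      range_eq := by
        refine Set.eq_univ_of_forall fun z => ⟨(⟨z.1, trivial⟩, z.2), rfl⟩
      proj := fun _ => rfl }⟩

end LocallyTrivial

/-! ### Gluing lifts of sections -/

section Gluing

open Opposite

variable {k : Type u} [CommRing k] {X : TopCat.{u}}

lemma exists_glue_sup (F : TopCat.Sheaf (ModuleCat.{u} k) X) {W₁ W₂ W : Opens X}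
    (h₁ : W₁ ≤ W) (h₂ : W₂ ≤ W) (hW : W ≤ W₁ ⊔ W₂) (s₁ : Sec F W₁) (s₂ : Sec F W₂)
    (h : resSec F (inf_le_left : W₁ ⊓ W₂ ≤ W₁) s₁ = resSec F inf_le_right s₂) :
    ∃ s : Sec F W, resSec F h₁ s = s₁ ∧ resSec F h₂ s = s₂ := by
  let U : Bool → Opens X := fun b => bif b then W₁ else W₂
  let sf : ∀ b, Sec F (U b) := fun b => match b with
    | true => s₁
    | false => s₂
  have hU : ∀ b, U b ≤ W := fun b => match b with
    | true => h₁
    | false => h₂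
  have hle : W ≤ iSup U := hW.trans (sup_le (le_iSup U true) (le_iSup U false))
  have hc : TopCat.Presheaf.IsCompatible F.1 U sf := by
    intro a b
    have h' := congrArg (resSec F (le_inf inf_le_right inf_le_left : W₂ ⊓ W₁ ≤ W₁ ⊓ W₂)) h
    rw [resSec_resSec, resSec_resSec] at h'
    match a, b with
    | true, true => rfl
    | false, false => rfl
    | true, false => exact h
    | false, true => exact h'.symm
  obtain ⟨s, hs, -⟩ := F.existsUnique_gluing' U W (fun b => homOfLE (hU b)) hle sf hc
  exact ⟨s, hs true, hs false⟩

/-- Each section extends, locally, to a global section. -/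
def LocallyExtends (F : TopCat.Sheaf (ModuleCat.{u} k) X) : Prop :=
  ∀ (W : Opens X) (s : Sec F W), ∀ x ∈ W, ∃ (W' : Opens X) (h : W' ≤ W) (g : Sec F ⊤),
    x ∈ W' ∧ resSec F h s = resSec F le_top g

lemma locallyExtends_constSheaf : LocallyExtends (constSheaf k X) := by
  intro W s x hx
  obtain ⟨W', h, r, hxW, hr⟩ := exists_smul_oneSec W s x hx
  exact ⟨W', h, r • oneSec k X, hxW, by rw [hr, map_smul]⟩

/-- Lift the section to `J` locally; flabbiness extends the lift globally. The property thus passes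
to the quotient `Q`, as dimension shifting requires. -/
lemma LocallyExtends.of_injective {J Q : TopCat.Sheaf (ModuleCat.{u} k) X} [Injective J]
    (p : J ⟶ Q) [hp : Epi p] : LocallyExtends Q := by
  intro W s x hx
  obtain ⟨W', h, hxW, t, ht⟩ := (epi_iff_locally_lift p).1 hp W s x hx
  obtain ⟨t', rfl⟩ := exists_resSec_eq_of_injective J (le_top : W' ≤ ⊤) t
  exact ⟨W', h, mapSec p ⊤ t', hxW, by rw [← ht, mapSec_resSec]⟩

/-- Two lifts differ on `C` by a section of the kernel `F` that extends to a global section `g`.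
Subtracting `g` from `t₁` makes the lifts agree on `C`. They are shrunk to `W₁'` and `W₂'` so that
their overlap lies in `C`, and then glue. -/
lemma exists_lift_of_lifts {F J Q : TopCat.Sheaf (ModuleCat.{u} k) X} {i : F ⟶ J} {p : J ⟶ Q}
    {h : i ≫ p = 0} {W W₁ W₂ W₁' W₂' C D : Opens X} (s : Sec Q W)
    (h₁ : W₁ ≤ W) (h₂ : W₂ ≤ W) (h₁' : W₁' ≤ W₁) (h₂' : W₂' ≤ W₂) (hC₁ : C ≤ W₁) (hC₂ : C ≤ W₂)
    (hC : W₁' ⊓ W₂' ≤ C) (hD : D ≤ W₁' ⊔ W₂') (hDW : D ≤ W)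
    (t₁ : Sec J W₁) (t₂ : Sec J W₂) (ht₁ : mapSec p _ t₁ = resSec Q h₁ s)
    (ht₂ : mapSec p _ t₂ = resSec Q h₂ s) (g : Sec F ⊤)
    (hg : resSec J hC₁ t₁ - resSec J hC₂ t₂ = mapSec i C (resSec F le_top g)) :
    ∃ t : Sec J D, mapSec p D t = resSec Q hDW s := by
  have hip : ∀ (V : Opens X) (x : Sec F V), mapSec p V (mapSec i V x) = 0 := fun V x =>
    congrArg (fun φ => mapSec φ V x) h
  obtain ⟨t, hta, htb⟩ := exists_glue_sup J (le_sup_left : W₁' ≤ W₁' ⊔ W₂') le_sup_right le_rfl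
    (resSec J h₁' t₁ - mapSec i W₁' (resSec F le_top g)) (resSec J h₂' t₂) (by
      have hg' := congrArg (resSec J hC) hg
      rw [map_sub, resSec_resSec, resSec_resSec, ← mapSec_resSec, resSec_resSec] at hg'
      rw [map_sub, resSec_resSec, resSec_resSec, ← mapSec_resSec, resSec_resSec, ← hg']
      abel)
  have hst : mapSec p _ t = resSec Q (sup_le (h₁'.trans h₁) (h₂'.trans h₂)) s := by
    refine resSec_eq_of_cover _ _ _ fun y hy => ?_
    rcases hy with hy | hy
    · refine ⟨W₁', le_sup_left, hy, ?_⟩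
      rw [← mapSec_resSec, hta, map_sub, hip, mapSec_resSec, ht₁, resSec_resSec, resSec_resSec,
        sub_zero]
    · refine ⟨W₂', le_sup_right, hy, ?_⟩
      rw [← mapSec_resSec, htb, mapSec_resSec, ht₂, resSec_resSec, resSec_resSec]
  exact ⟨resSec J hD t, by rw [mapSec_resSec, hst, resSec_resSec]⟩

end Gluing

/-! ### Homotopy invariance -/

section Interval

open Opposite unitInterval

variable {k : Type u} [CommRing k] {X : Type u} [TopologicalSpace X]

/-- The projection `X × [0, 1] → X`. -/
abbrev cylProj (X : Type u) [TopologicalSpace X] : C(X × I, X) := ContinuousMap.fst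

/-- The open box `U × A` in `X × [0, 1]`. -/
def box (U : Opens X) (A : Opens I) : Opens (TopCat.of (X × I)) := ⟨U ×ˢ A, U.2.prod A.2⟩

lemma box_mono {U U' : Opens X} {A A' : Opens I} (h : U' ≤ U) (h' : A' ≤ A) :
    box U' A' ≤ box U A := fun _ hz => ⟨h hz.1, h' hz.2⟩

lemma exists_box (W : Opens (TopCat.of (X × I))) (x : X) (t : I) (h : (x, t) ∈ W) :
    ∃ (U : Opens X) (A : Opens I), x ∈ U ∧ t ∈ A ∧ box U A ≤ W := by
  obtain ⟨u, v, hu, hv, hx, ht, huv⟩ := isOpen_prod_iff.1 W.2 x t h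
  exact ⟨⟨u, hu⟩, ⟨v, hv⟩, hx, ht, huv⟩

/-- Sections that can be lifted locally along an epimorphism whose kernel has the local extension
property can be lifted over a neighbourhood of `{x} × [0, 1]`. -/
theorem exists_lift_cylinder {F J Q : TopCat.Sheaf (ModuleCat.{u} k) (TopCat.of (X × I))}
    {i : F ⟶ J} {p : J ⟶ Q} {h : i ≫ p = 0} (hS : (ShortComplex.mk i p h).ShortExact)
    (hF : LocallyExtends F) (U : Opens (TopCat.of X))
    (s : Sec Q ((Opens.map (TopCat.ofHom (cylProj X))).obj U)) (x : X) (hx : x ∈ U) :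
    ∃ (U' : Opens (TopCat.of X)) (hU : U' ≤ U), x ∈ U' ∧
      ∃ t : Sec J ((Opens.map (TopCat.ofHom (cylProj X))).obj U'),
        mapSec p _ t = resSec Q ((Opens.map (TopCat.ofHom (cylProj X))).monotone hU) s := by
  have hp : Epi p := hS.epi_g
  have hloc : ∀ t : I, ∃ (V : Opens X) (A : Opens I)
      (hV : box V A ≤ (Opens.map (TopCat.ofHom (cylProj X))).obj U), x ∈ V ∧ t ∈ A ∧
        ∃ l : Sec J (box V A), mapSec p _ l = resSec Q hV s := by
    intro t
    obtain ⟨W, hW, hxW, l, hl⟩ := (epi_iff_locally_lift p).1 hp _ s (x, t) hx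
    obtain ⟨V, A, hxV, htA, hVA⟩ := exists_box W x t hxW
    exact ⟨V, A, hVA.trans hW, hxV, htA, resSec J hVA l, by
      rw [mapSec_resSec, hl, resSec_resSec]⟩
  choose V A hV hxV htA l hl using hloc
  -- Compactness of the interval: each piece `[τ n, τ (n + 1)]` lies in a single `A t`. The lift is
  -- then extended one piece at a time.
  obtain ⟨τ, hτ0, hτm, ⟨N, hN⟩, hτ⟩ := exists_monotone_Icc_subset_open_cover_unitInterval
    (fun t => (A t).2) (fun t _ => Set.mem_iUnion.2 ⟨t, htA t⟩)
  have key : ∀ n : ℕ, ∃ (V' : Opens X) (A' : Opens I)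
      (hV' : box V' A' ≤ (Opens.map (TopCat.ofHom (cylProj X))).obj U), x ∈ V' ∧
        Set.Icc 0 (τ n) ⊆ A' ∧ ∃ l' : Sec J (box V' A'), mapSec p _ l' = resSec Q hV' s := by
    intro n
    induction n with
    | zero =>
      refine ⟨V 0, A 0, hV 0, hxV 0, ?_, l 0, hl 0⟩
      rw [hτ0, Set.Icc_self, Set.singleton_subset_iff]
      exact htA 0
    | succ n ih =>
      obtain ⟨V', A', hV', hxV', hA', l', hl'⟩ := ih
      obtain ⟨t, ht⟩ := hτ n
      have hmem' : τ n ∈ A' := hA' ⟨unitInterval.nonneg', le_rfl⟩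
      have hmem : τ n ∈ A t := ht ⟨le_rfl, hτm n.le_succ⟩
      have hd : mapSec p (box (V' ⊓ V t) (A' ⊓ A t)) (resSec J (box_mono inf_le_left inf_le_left) l' -
          resSec J (box_mono inf_le_right inf_le_right) (l t)) = 0 := by
        rw [map_sub, mapSec_resSec, mapSec_resSec, hl', hl, resSec_resSec, resSec_resSec, sub_self]
      obtain ⟨d, hd'⟩ := exists_mapSec_eq_of_exact hS _ hd
      -- Only the discrepancy `d` near the junction `(x, τ n)` matters, and there it extends
      -- globally.
      obtain ⟨C, hC, g, hxC, hg⟩ := hF _ d (x, τ n) ⟨⟨hxV', hxV t⟩, hmem', hmem⟩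
      obtain ⟨V'', B, hxV'', hB, hVB⟩ := exists_box C x (τ n) hxC
      have hVB' := hVB.trans hC
      have hV'' : V'' ≤ V' ⊓ V t := fun y hy => (hVB' (show (y, τ n) ∈ box V'' B from ⟨hy, hB⟩)).1
      have hB' : B ≤ A' ⊓ A t := fun r hr => (hVB' (show (x, r) ∈ box V'' B from ⟨hxV'', hr⟩)).2
      -- The old lift is kept below `τ n` and the new one above it, both enlarged by `B`, so that
      -- they overlap in `B` only.
      let A₁ : Opens I := (A' ⊓ ⟨Set.Iio (τ n), isOpen_Iio⟩) ⊔ B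
      let A₂ : Opens I := (A t ⊓ ⟨Set.Ioi (τ n), isOpen_Ioi⟩) ⊔ B
      have hA₁ : A₁ ≤ A' := sup_le inf_le_left (hB'.trans inf_le_left)
      have hA₂ : A₂ ≤ A t := sup_le inf_le_left (hB'.trans inf_le_right)
      have hDW : box V'' (A₁ ⊔ A₂) ≤ (Opens.map (TopCat.ofHom (cylProj X))).obj U := fun z hz => by
        have hz' := hV' (show (z.1, τ n) ∈ box V' A' from ⟨(hV'' hz.1).1, hmem'⟩)
        exact hz'
      refine ⟨V'', A₁ ⊔ A₂, hDW, hxV'', ?_, ?_⟩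
      · rintro r ⟨hr0, hr⟩
        rcases lt_trichotomy r (τ n) with hlt | rfl | hgt
        · exact Or.inl (Or.inl ⟨hA' ⟨hr0, hlt.le⟩, hlt⟩)
        · exact Or.inl (Or.inr hB)
        · exact Or.inr (Or.inl ⟨ht ⟨hgt.le, hr⟩, hgt⟩)
      · refine exists_lift_of_lifts (i := i) (h := h) s hV' (hV t)
          (box_mono (hV''.trans inf_le_left) hA₁)
          (box_mono (hV''.trans inf_le_right) hA₂) (C := box V'' B)
          (hVB'.trans (box_mono inf_le_left inf_le_left))
          (hVB'.trans (box_mono inf_le_right inf_le_right)) ?_ ?_ hDW l' (l t) hl' (hl t) g ?_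
        · rintro z ⟨⟨hz1, hz | hz⟩, ⟨-, hz' | hz'⟩⟩
          · exact (lt_asymm (show z.2 < τ n from hz.2) hz'.2).elim
          · exact ⟨hz1, hz'⟩
          · exact ⟨hz1, hz⟩
          · exact ⟨hz1, hz⟩
        · rintro z ⟨hz1, hz | hz⟩
          · exact Or.inl ⟨hz1, hz⟩
          · exact Or.inr ⟨hz1, hz⟩
        · have e := congrArg (resSec J hVB') hd'
          rw [map_sub, resSec_resSec, resSec_resSec, ← mapSec_resSec] at e
          rw [← e]
          have e' := congrArg (resSec F hVB) hg
          rw [resSec_resSec, resSec_resSec] at e'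
          rw [e']
  obtain ⟨V', A', hV', hxV', hA', l', hl'⟩ := key N
  rw [hN N le_rfl] at hA'
  have hle : V' ≤ U := fun y hy =>
    hV' (show (y, 0) ∈ box V' A' from ⟨hy, hA' ⟨le_rfl, unitInterval.le_one'⟩⟩)
  have hbox : (Opens.map (TopCat.ofHom (cylProj X))).obj V' ≤ box V' A' := fun z hz =>
    ⟨hz, hA' ⟨unitInterval.nonneg', unitInterval.le_one'⟩⟩
  exact ⟨V', hle, hxV', resSec J hbox l', by rw [mapSec_resSec, hl', resSec_resSec]⟩

/-- A class of degree one is an obstruction removed by `exists_lift_cylinder`. Higher degrees follow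
by dimension shifting, as the cokernel of an embedding into an injective sheaf again satisfies
`LocallyExtends`. -/
theorem higherDirectImagesVanish_cylProj
    {F : TopCat.Sheaf (ModuleCat.{u} k) (TopCat.of (X × I))} (hF : LocallyExtends F) :
    HigherDirectImagesVanish (TopCat.ofHom (cylProj X)) F := by
  intro n
  induction n generalizing F with
  | zero =>
    intro U x hx y
    obtain ⟨J, Q, hJ, i, p, h, hS, z, rfl⟩ := exists_comp_extClass y
    obtain ⟨g, rfl⟩ := (Ext.mk₀_bijective _ _).2 z
    obtain ⟨U', hU, hxU, t, ht⟩ := exists_lift_cylinder hS hF U (mapSec g _ (gen k _)) x hx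
    refine ⟨U', hU, hxU, mk₀_comp_comp_extClass_eq_zero hS _ _ (secHom t) ?_⟩
    rw [secHom_comp, ht, ← mapSec_resSec, ← mapSec_freeIncl, ← mapSec_comp, ← eq_secHom]
  | succ n ih =>
    intro U x hx y
    obtain ⟨J, Q, hJ, i, p, h, hS, z, rfl⟩ := exists_comp_extClass y
    have hp : Epi p := hS.epi_g
    obtain ⟨U', hU, hxU, h0⟩ := ih (LocallyExtends.of_injective p) U x hx z
    refine ⟨U', hU, hxU, ?_⟩
    rw [← Ext.comp_assoc _ _ _ (zero_add _) rfl (by omega), h0, Ext.zero_comp]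

theorem pullbackDeg_cylProj_bijective (n : ℕ) :
    Function.Bijective (pullbackDeg k (cylProj X) n) :=
  pullbackDeg_bijective (cylProj X) (fun x => ⟨(x, 0), rfl⟩)
    (isFibreBundle_fst X I).locallyConstantSectionsDescend
    (higherDirectImagesVanish_cylProj locallyExtends_constSheaf) n

/-- Homotopy invariance of sheaf cohomology with constant coefficients. -/
theorem pullbackDeg_eq_of_homotopic {Y : Type u} [TopologicalSpace Y] {f g : C(X, Y)}
    (h : f.Homotopic g) {n : ℕ} (y : HDeg k Y n) : pullbackDeg k f n y = pullbackDeg k g n y := by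
  obtain ⟨H⟩ := h
  let K : C(X × I, Y) := H.toContinuousMap.comp ContinuousMap.prodSwap
  let i (t : I) : C(X, X × I) := (ContinuousMap.id X).prodMk (ContinuousMap.const X t)
  -- Each `i t` is a section of the projection, so its pull-back inverts the bijective pull-back
  -- along the projection, whatever `t` is.
  have hi : ∀ t (z : HDeg k (X × I) n), ∃ w, pullbackDeg k (i t) n z = w ∧
      pullbackDeg k (cylProj X) n w = z := by
    intro t z
    obtain ⟨w, rfl⟩ := (pullbackDeg_cylProj_bijective n).2 z
    refine ⟨w, ?_, rfl⟩
    rw [← pullbackDeg_comp]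
    exact pullbackDeg_id k w
  have h01 : pullbackDeg k (i 0) n (pullbackDeg k K n y) =
      pullbackDeg k (i 1) n (pullbackDeg k K n y) := by
    obtain ⟨w, hw, hw'⟩ := hi 0 (pullbackDeg k K n y)
    obtain ⟨v, hv, hv'⟩ := hi 1 (pullbackDeg k K n y)
    rw [hw, hv]
    exact (pullbackDeg_cylProj_bijective n).1 (hw'.trans hv'.symm)
  have hf : K.comp (i 0) = f := by
    ext x
    exact H.apply_zero x
  have hg : K.comp (i 1) = g := by
    ext x
    exact H.apply_one x
  rw [← pullbackDeg_comp, ← pullbackDeg_comp, hf, hg] at h01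
  exact h01

/-- The section through the point `y` to which `F` contracts is a homotopy inverse of the
projection. -/
theorem pullbackDeg_fst_bijective (F : Type u) [TopologicalSpace F] [ContractibleSpace F]
    (n : ℕ) : Function.Bijective (pullbackDeg k (ContinuousMap.fst : C(X × F, X)) n) := by
  obtain ⟨y, hy⟩ := id_nullhomotopic F
  let s : C(X, X × F) := (ContinuousMap.id X).prodMk (ContinuousMap.const X y)
  refine Function.bijective_iff_has_inverse.2 ⟨pullbackDeg k s n, fun x => ?_, fun z => ?_⟩
  · rw [← pullbackDeg_comp]
    exact pullbackDeg_id k x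
  · rw [← pullbackDeg_comp]
    have h : (ContinuousMap.id (X × F)).Homotopic (s.comp ContinuousMap.fst) :=
      (ContinuousMap.Homotopic.refl (ContinuousMap.id X)).prodMap hy
    rw [← pullbackDeg_eq_of_homotopic h, pullbackDeg_id]

end Interval

/-! ### The Vietoris–Begle theorem for fibre bundles -/

section FibreBundle

variable {k : Type u} [CommRing k]

lemma mk₀_comp_mapExactFunctor_eq_zero {C D : Type*} [Category C] [Abelian C] [HasExt.{u} C]
    [Category D] [Abelian D] [HasExt.{u} D] (L : C ⥤ D) [L.Additive] [PreservesFiniteLimits L]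
    [PreservesFiniteColimits L] {A A' M : C} {f : A' ⟶ A} {n : ℕ} {x : Ext A M n}
    (h : (Ext.mk₀ f).comp x (zero_add n) = 0) :
    (Ext.mk₀ (L.map f)).comp (x.mapExactFunctor L) (zero_add n) = 0 := by
  rw [← Ext.mapExactFunctor_mk₀, ← Ext.mapExactFunctor_comp, h, Ext.mapExactFunctor_zero]

lemma comp_eq_zero_of_mk₀_comp_eq {C : Type*} [Category C] [Abelian C] [HasExt.{u} C]
    {N A B A' B' : C} {f : N ⟶ A} {e : A ⟶ A'} {e' : B ⟶ B'} {n : ℕ} {x : Ext A B n}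
    {y : Ext A' B' n} (h : (Ext.mk₀ e).comp y (zero_add n) = x.comp (Ext.mk₀ e') (add_zero n))
    (h0 : (Ext.mk₀ f).comp x (zero_add n) = 0) :
    (Ext.mk₀ (f ≫ e)).comp y (zero_add n) = 0 := by
  rw [← Ext.mk₀_comp_mk₀_assoc, h, ← Ext.comp_assoc_of_third_deg_zero, h0, Ext.zero_comp]

/-- A class of positive degree on the total space that is pulled back from the base vanishes
locally over the base. -/
lemma exists_comp_eq_zero_of_surjective_pullbackDeg {V U : Type u} [TopologicalSpace V]
    [TopologicalSpace U] (q : C(V, U)) {n : ℕ}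
    (hq : Function.Surjective (pullbackDeg k q (n + 1)))
    (x : Ext (constSheaf k (TopCat.of V)) (constSheaf k (TopCat.of V)) (n + 1)) (b : U) :
    ∃ U' : Opens (TopCat.of U), b ∈ U' ∧
      (Ext.mk₀ ((TopCat.Sheaf.pullback (ModuleCat.{u} k) (TopCat.ofHom q)).map
        (secHom (resSec _ (le_top : U' ≤ ⊤) (oneSec k (TopCat.of U)))) ≫
          (constSheafPullbackIso k (TopCat.ofHom q)).hom)).comp x (zero_add _) = 0 := by
  obtain ⟨y, rfl⟩ := hq x
  obtain ⟨U', h, hb, h0⟩ := exists_comp_eq_zero_of_pos (oneSec k (TopCat.of U)) y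
    (show b ∈ (⊤ : Opens (TopCat.of U)) from trivial)
  refine ⟨U', hb, ?_⟩
  exact comp_eq_zero_of_mk₀_comp_eq (mk₀_comp_pullbackDeg k q y)
    (mk₀_comp_mapExactFunctor_eq_zero _ h0)

lemma comp_eq_zero_of_comp_mk₀_iso {C : Type*} [Category C] [Abelian C] [HasExt.{u} C]
    {A B D : C} (e : B ≅ D) {n : ℕ} {x : Ext A B n}
    (h : x.comp (Ext.mk₀ e.hom) (add_zero n) = 0) : x = 0 := by
  have := congrArg (fun z => z.comp (Ext.mk₀ e.inv) (add_zero n)) h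
  simpa using this

/-- Over a trivialising `U₁`, the class `x` gives a class on `U₁ × F`. This comes from `U₁` by
contractibility of `F`, so it vanishes over a smaller open set of the base; excision carries the
vanishing back to `Y`. -/
theorem IsFibreBundle.higherDirectImagesVanish {B Y F : Type u} [TopologicalSpace B]
    [TopologicalSpace Y] [TopologicalSpace F] [ContractibleSpace F] {p : C(Y, B)}
    (hp : IsFibreBundle p F) :
    HigherDirectImagesVanish (TopCat.ofHom p) (constSheaf k (TopCat.of Y)) := by
  intro n U b hb x
  obtain ⟨U₁, j₀, hU₁, hb₁, hj₀⟩ := hp.exists_le U hb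
  let j : C(U₁ × F, Y) := ⟨j₀, hj₀.isOpenEmbedding.continuous⟩
  let q : C(U₁ × F, U₁) := ContinuousMap.fst
  let W₁ := (Opens.map (TopCat.ofHom p)).obj U₁
  let x₁ : Ext (freeSheaf k W₁) _ (n + 1) :=
    (Ext.mk₀ (freeIncl ((Opens.map (TopCat.ofHom p)).monotone hU₁))).comp x (zero_add _)
  have hW₁ : ⊤ ≤ (Opens.map (TopCat.ofHom j)).obj W₁ := fun z _ => by
    change p (j₀ z) ∈ U₁
    rw [hj₀.proj]
    exact z.1.2
  -- Composition with `θ` turns `j⁻¹ x₁` into a class on the constant sheaf, to which pull-back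
  -- along `q` applies.
  obtain ⟨θ, hθ⟩ := (oneSec_universal (k := k) _).2
    (resSec _ hW₁ (pullSec (TopCat.ofHom j) (gen k W₁)))
  obtain ⟨U', hbU', h0⟩ := exists_comp_eq_zero_of_surjective_pullbackDeg q
    (pullbackDeg_fst_bijective F (n + 1)).2
    ((Ext.mk₀ θ).comp ((x₁.mapExactFunctor (TopCat.Sheaf.pullback (ModuleCat.{u} k)
      (TopCat.ofHom j))).comp (Ext.mk₀ (constSheafPullbackIso k (TopCat.ofHom j)).hom)
        (add_zero _)) (zero_add _)) (⟨b, hb₁⟩ : U₁)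
  let U'' : Opens (TopCat.of B) := ⟨Subtype.val '' (U' : Set U₁),
    U₁.2.isOpenMap_subtype_val _ U'.2⟩
  have hU'' : U'' ≤ U₁ := by
    rintro _ ⟨u, -, rfl⟩
    exact u.2
  have hW : (Opens.map (TopCat.ofHom j)).obj ((Opens.map (TopCat.ofHom p)).obj U'') ≤
      (Opens.map (TopCat.ofHom q)).obj U' := by
    rintro z ⟨u, hu, huz⟩
    have : u = z.1 := Subtype.ext (huz.trans (hj₀.proj z))
    change z.1 ∈ U'
    rwa [← this]
  refine ⟨U'', hU''.trans hU₁, ⟨_, hbU', rfl⟩, ?_⟩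
  have hincl : (Ext.mk₀ (freeIncl ((Opens.map (TopCat.ofHom p)).monotone
      (hU''.trans hU₁)))).comp x (zero_add _) =
      (Ext.mk₀ (freeIncl ((Opens.map (TopCat.ofHom p)).monotone hU''))).comp x₁ (zero_add _) := by
    rw [Ext.mk₀_comp_mk₀_assoc, freeIncl_comp]
  rw [hincl]
  refine eq_zero_of_mapExactFunctor_pullback_eq_zero (j := TopCat.ofHom j) hj₀.isOpenEmbedding
    ?_ _ ?_
  · intro y hy
    change y ∈ Set.range j₀
    rw [hj₀.range_eq]
    exact hU'' hy
  -- Through `a`, the pulled-back inclusion factors over the morphism that kills the class in `h0`;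
  -- this is `hfac`, checked on the generator.
  obtain ⟨a, ha⟩ := ((gen_universal (k := k) _).pullSec (TopCat.ofHom j) _).2
    (resSec _ hW (pullSec (TopCat.ofHom q) (gen k U')))
  have hfac : (TopCat.Sheaf.pullback (ModuleCat.{u} k) (TopCat.ofHom j)).map
      (freeIncl ((Opens.map (TopCat.ofHom p)).monotone hU'')) =
      a ≫ ((TopCat.Sheaf.pullback (ModuleCat.{u} k) (TopCat.ofHom q)).map
        (secHom (resSec _ (le_top : U' ≤ ⊤) (oneSec k (TopCat.of U₁)))) ≫
          (constSheafPullbackIso k (TopCat.ofHom q)).hom) ≫ θ := by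
    apply ((gen_universal (k := k) _).pullSec (TopCat.ofHom j)).hom_ext
    dsimp only at ha hθ
    rw [mapSec_comp, mapSec_comp, mapSec_comp, mapSec_pullback_map, mapSec_freeIncl,
      pullSec_resSec, ha, mapSec_resSec, mapSec_pullback_map, mapSec_secHom, pullSec_resSec,
      resSec_resSec, mapSec_resSec]
    have h1 := mapSec_constSheafPullbackIso (k := k) (TopCat.ofHom q)
    refine Eq.trans ?_ (congrArg (fun s => mapSec θ _ (resSec _ _ s)) h1).symm
    refine Eq.trans ?_ ((congrArg (resSec _
      (le_top : _ ≤ (⊤ : Opens (TopCat.of (U₁ × F))))) hθ).symm.trans (mapSec_resSec θ le_top _).symm)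
    exact (resSec_resSec _ _ _ _).symm
  apply comp_eq_zero_of_comp_mk₀_iso (constSheafPullbackIso k (TopCat.ofHom j))
  rw [Ext.mapExactFunctor_comp, Ext.mapExactFunctor_mk₀, hfac, ← Ext.mk₀_comp_mk₀_assoc,
    ← Ext.mk₀_comp_mk₀_assoc]
  rw [Ext.comp_assoc_of_third_deg_zero, Ext.comp_assoc_of_third_deg_zero,
    Ext.comp_assoc_of_third_deg_zero, h0, Ext.comp_zero]

/-- The Vietoris–Begle theorem for fibre bundles with contractible fibres. -/
theorem IsFibreBundle.pullbackDeg_bijective {B Y F : Type u} [TopologicalSpace B]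
    [TopologicalSpace Y] [TopologicalSpace F] [ContractibleSpace F] {p : C(Y, B)}
    (hp : IsFibreBundle p F) (n : ℕ) : Function.Bijective (pullbackDeg k p n) :=
  EquivCoh.pullbackDeg_bijective p hp.surjective hp.locallyConstantSectionsDescend
    hp.higherDirectImagesVanish n

end FibreBundle

/-! ### Orbit spaces of diagonal actions as fibre bundles -/

section OrbitSpaces

open Topology

lemma orbitMap_eq_iff {H S : Type u} [Group H] [MulAction H S] {s t : S} :
    orbitMap H S s = orbitMap H S t ↔ ∃ g : H, g • t = s :=
  Quotient.eq.trans MulAction.orbitRel_apply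

variable (H : Type u) [Group H] [TopologicalSpace H]

/-- Locally over the orbit space, the `H`-space `S` admits an equivariant continuous map to `H`. -/
def HasLocalCoordinates (S : Type u) [TopologicalSpace S] [MulAction H S] : Prop :=
  ∀ b : OrbitSpace H S, ∃ (U : Opens (OrbitSpace H S)) (γ : orbitMap H S ⁻¹' U → H), b ∈ U ∧
    Continuous γ ∧ ∀ (g : H) (s s' : orbitMap H S ⁻¹' U), (s' : S) = g • (s : S) → γ s' = g * γ s

variable {H} {S S' T : Type u} [TopologicalSpace S] [TopologicalSpace S'] [TopologicalSpace T]
  [MulAction H S] [MulAction H S'] [MulAction H T]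

lemma IsPrincipalBundle.hasLocalCoordinates (h : IsPrincipalBundle H (orbitMap H S)) :
    HasLocalCoordinates H S := by
  intro b
  obtain ⟨U, hU, hb, e, he, hmul⟩ := h.locally_trivial b
  refine ⟨⟨U, hU⟩, fun s => (e.symm s).1, hb, continuous_fst.comp e.symm.continuous, ?_⟩
  intro g s s' hs
  obtain ⟨⟨g₀, u⟩, rfl⟩ := e.surjective s
  have h' : e (g * g₀, u) = s' := Subtype.ext ((hmul g g₀ u).trans hs.symm)
  change (e.symm s').1 = g * (e.symm (e (g₀, u))).1
  rw [← h', e.symm_apply_apply, e.symm_apply_apply]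

/-- The map of orbit spaces induced by an equivariant continuous map. -/
def orbitSpaceMap (f : C(S', S)) (hf : ∀ (g : H) (s : S'), f (g • s) = g • f s) :
    C(OrbitSpace H S', OrbitSpace H S) where
  toFun := Quotient.lift (fun s => orbitMap H S (f s)) (by
    rintro _ s ⟨g, rfl⟩
    exact Quotient.sound ⟨g, (hf g s).symm⟩)
  continuous_toFun := Continuous.quotient_lift (continuous_quotient_mk'.comp f.continuous) _

/-- Applied to `X × E → E`, this covers the Borel construction without making `X × E` a principal
bundle first. -/
lemma HasLocalCoordinates.of_map (h : HasLocalCoordinates H S) (f : C(S', S))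
    (hf : ∀ (g : H) (s : S'), f (g • s) = g • f s) : HasLocalCoordinates H S' := by
  intro b
  obtain ⟨U, γ, hb, hγ, hmul⟩ := h (orbitSpaceMap f hf b)
  refine ⟨U.comap (orbitSpaceMap f hf), fun s => γ ⟨f s, s.2⟩, hb,
    hγ.comp ((f.continuous.comp continuous_subtype_val).subtype_mk _), fun g s s' hs => ?_⟩
  exact hmul g _ _ ((congrArg f hs).trans (hf g s))

/-- If `S` has local coordinates, then `H \ (S × T) → H \ S` is a fibre bundle with fibre `T`. -/
theorem HasLocalCoordinates.isFibreBundle [IsTopologicalGroup H] [ContinuousSMul H S]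
    [ContinuousSMul H S'] [ContinuousSMul H T] (h : HasLocalCoordinates H S) (Φ : S' ≃ₜ S × T)
    (f : C(S', S)) (hf : ∀ (g : H) (s : S'), f (g • s) = g • f s) (hΦ : ∀ s, (Φ s).1 = f s)
    (hΦ' : ∀ (g : H) (s : S'), Φ (g • s) = g • Φ s) : IsFibreBundle (orbitSpaceMap f hf) T := by
  intro b
  obtain ⟨U, γ, hb, hγ, hmul⟩ := h b
  have hΦs : ∀ (g : H) (z : S × T), Φ.symm (g • z) = g • Φ.symm z := fun g z => by
    rw [Φ.symm_apply_eq, hΦ', Φ.apply_symm_apply]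
  let P := orbitMap H S ⁻¹' U
  let q : P → U := fun s => ⟨orbitMap H S s, s.2⟩
  have hqS : IsOpenQuotientMap (orbitMap H S) := MulAction.isOpenQuotientMap_quotientMk
  have hq : IsOpenQuotientMap q := hqS.restrictPreimage (U : Set (OrbitSpace H S))
  let c : P × T → OrbitSpace H S' := fun z => orbitMap H S' (Φ.symm (z.1, γ z.1 • z.2))
  -- The shear untwists the diagonal action: by equivariance of `γ`, the orbit of `(s, γ s • t)`
  -- depends only on `t` and the orbit of `s`.
  let shear : P × T ≃ₜ P × T :=
    { toFun := fun z => (z.1, γ z.1 • z.2)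
      invFun := fun z => (z.1, (γ z.1)⁻¹ • z.2)
      left_inv := fun z => by simp
      right_inv := fun z => by simp
      continuous_toFun := continuous_fst.prodMk ((hγ.comp continuous_fst).smul continuous_snd)
      continuous_invFun :=
        continuous_fst.prodMk ((hγ.comp continuous_fst).inv.smul continuous_snd) }
  have hPo : IsOpen P := U.2.preimage continuous_quotient_mk'
  have hc : IsOpenMap c := (MulAction.isOpenQuotientMap_quotientMk (Γ := H) (T := S')).isOpenMap.comp
    (Φ.symm.isOpenMap.comp ((hPo.isOpenMap_subtype_val.prodMap IsOpenMap.id).comp shear.isOpenMap))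
  have hcc : Continuous c := continuous_quotient_mk'.comp (Φ.symm.continuous.comp
    ((continuous_subtype_val.prodMap continuous_id).comp shear.continuous))
  have hc_iff : ∀ s s' t t', c (s, t) = c (s', t') ↔ q s = q s' ∧ t = t' := by
    intro s s' t t'
    change orbitMap H S' _ = orbitMap H S' _ ↔ _
    rw [orbitMap_eq_iff, Subtype.ext_iff]
    change _ ↔ orbitMap H S s = orbitMap H S s' ∧ _
    rw [orbitMap_eq_iff]
    constructor
    · rintro ⟨g, hg⟩
      rw [← hΦs] at hg
      have hg' := Φ.symm.injective hg
      have h₁ : g • (s' : S) = s := congrArg Prod.fst hg'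
      have h₂ : g • γ s' • t' = γ s • t := congrArg Prod.snd hg'
      rw [hmul g s' s h₁.symm, mul_smul] at h₂
      exact ⟨⟨g, h₁⟩, (smul_left_cancel _ (smul_left_cancel _ h₂)).symm⟩
    · rintro ⟨⟨g, hg⟩, rfl⟩
      refine ⟨g, ?_⟩
      rw [← hΦs, hmul g s' s hg.symm, mul_smul, ← hg]
      rfl
  -- The section of `q` is merely set-theoretic. Continuity and openness of `j` come from those of
  -- `c`, as `q × id` is an open quotient map.
  let j : U × T → OrbitSpace H S' := fun z => c (Function.surjInv hq.surjective z.1, z.2)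
  have hjc : j ∘ Prod.map q id = c := funext fun z =>
    (hc_iff _ _ _ _).2 ⟨Function.surjInv_eq hq.surjective _, rfl⟩
  have hqT : IsOpenQuotientMap (Prod.map q (id : T → T)) := hq.prodMap .id
  have hproj : ∀ z, orbitSpaceMap f hf (c z) = orbitMap H S z.1 := fun z => by
    change orbitMap H S (f (Φ.symm _)) = _
    rw [← hΦ, Φ.apply_symm_apply]
  refine ⟨U, j, hb, ?_, ?_, ?_⟩
  · refine .of_continuous_injective_isOpenMap ?_ ?_ ?_
    · rw [hqT.isQuotientMap.continuous_iff, hjc]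
      exact hcc
    · intro z z' hz
      obtain ⟨h₁, h₂⟩ := (hc_iff _ _ _ _).1 hz
      rw [Function.surjInv_eq hq.surjective, Function.surjInv_eq hq.surjective] at h₁
      exact Prod.ext h₁ h₂
    · refine IsOpenMap.of_comp (f := Prod.map q id) hqT.continuous hqT.surjective ?_
      rw [hjc]
      exact hc
  · apply Set.Subset.antisymm
    · rintro _ ⟨z, rfl⟩
      change orbitSpaceMap f hf (c _) ∈ U
      rw [hproj]
      exact (Function.surjInv hq.surjective z.1).2
    · intro y hy
      obtain ⟨s, rfl⟩ := Quotient.exists_rep y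
      have hs : f s ∈ P := hy
      refine ⟨(q ⟨f s, hs⟩, (γ ⟨f s, hs⟩)⁻¹ • (Φ s).2), ?_⟩
      refine (congrFun hjc (⟨f s, hs⟩, (γ ⟨f s, hs⟩)⁻¹ • (Φ s).2)).trans ?_
      change orbitMap H S' (Φ.symm (f s, γ ⟨f s, hs⟩ • (γ ⟨f s, hs⟩)⁻¹ • (Φ s).2)) = orbitMap H S' s
      rw [smul_inv_smul, ← hΦ, Φ.symm_apply_apply]
  · intro z
    refine (hproj _).trans ?_
    exact congrArg Subtype.val (Function.surjInv_eq hq.surjective z.1)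

end OrbitSpaces

/-! ### Graded pull-backs and roofs of cohomology isomorphisms -/

section GradedPullback

lemma toAlgebra_lof {ι R B : Type*} {A : ι → Type*} [DecidableEq ι] [AddMonoid ι] [CommSemiring R]
    [∀ i, AddCommMonoid (A i)] [∀ i, Module R (A i)] [DirectSum.GSemiring A]
    [DirectSum.GAlgebra R A] [Semiring B] [Algebra R B] (f : ∀ i, A i →ₗ[R] B)
    (hone : f _ GradedMonoid.GOne.one = 1)
    (hmul : ∀ {i j} (ai : A i) (aj : A j), f _ (GradedMonoid.GMul.mul ai aj) = f _ ai * f _ aj)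
    (i : ι) (x : A i) : DirectSum.toAlgebra R A f hone hmul (DirectSum.lof R ι A i x) = f i x :=
  DirectSum.toSemiring_of (fun i => (f i).toAddMonoidHom) hone @hmul i x

variable {k : Type u} [CommRing k] {X Y Z : Type u} [TopologicalSpace X] [TopologicalSpace Y]
  [TopologicalSpace Z]

lemma pullback_lof (f : C(X, Y)) (n : ℕ) (y : HDeg k Y n) :
    pullback k f (DirectSum.lof k ℕ (HDeg k Y) n y) =
      DirectSum.lof k ℕ (HDeg k X) n (pullbackDeg k f n y) :=
  toAlgebra_lof (fun n => (DirectSum.lof k ℕ (HDeg k X) n).comp (pullbackDeg k f n))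
    (congrArg (DirectSum.lof k ℕ (HDeg k X) 0) (pullbackDeg_unit k f))
    (fun {i j} a b => by
      refine (congrArg (DirectSum.lof k ℕ (HDeg k X) (i + j)) (pullbackDeg_cup k f a b)).trans ?_
      exact (DirectSum.of_mul_of _ _).symm) n y

lemma pullback_toLinearMap (f : C(X, Y)) :
    (pullback k f).toLinearMap = DirectSum.lmap (pullbackDeg k f) := by
  refine DirectSum.linearMap_ext k fun n => LinearMap.ext fun y => ?_
  exact (pullback_lof f n y).trans (DirectSum.lmap_lof _ n y).symm

lemma pullback_comp (f : C(X, Y)) (g : C(Y, Z)) (z : H k Z) :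
    pullback k (g.comp f) z = pullback k f (pullback k g z) := by
  have : (pullback k (g.comp f)).toLinearMap =
      (pullback k f).toLinearMap.comp (pullback k g).toLinearMap := by
    refine DirectSum.linearMap_ext k fun n => LinearMap.ext fun y => ?_
    change pullback k (g.comp f) (DirectSum.lof k ℕ (HDeg k Z) n y) =
      pullback k f (pullback k g (DirectSum.lof k ℕ (HDeg k Z) n y))
    rw [pullback_lof, pullback_lof, pullback_lof, pullbackDeg_comp]
  exact congrArg (fun φ => φ z) this

lemma pullback_mem_homog (f : C(X, Y)) {n : ℕ} {y : H k Y} (hy : y ∈ homog k Y n) :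
    pullback k f y ∈ homog k X n := by
  obtain ⟨y, rfl⟩ := hy
  exact ⟨_, (pullback_lof f n y).symm⟩

variable (k) in
/-- A continuous map that induces isomorphisms in cohomology. -/
def IsCohomologyIso (f : C(X, Y)) : Prop := ∀ n, Function.Bijective (pullbackDeg k f n)

lemma IsCohomologyIso.bijective {f : C(X, Y)} (hf : IsCohomologyIso k f) :
    Function.Bijective (pullback k f) := by
  change Function.Bijective (pullback k f).toLinearMap
  rw [pullback_toLinearMap]
  exact ⟨(DirectSum.lmap_injective _).2 fun n => (hf n).1,
    (DirectSum.lmap_surjective _).2 fun n => (hf n).2⟩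

/-- The isomorphism of graded algebras induced by a cohomology isomorphism. -/
def IsCohomologyIso.algEquiv {f : C(X, Y)} (hf : IsCohomologyIso k f) : H k Y ≃ₐ[k] H k X :=
  AlgEquiv.ofBijective (pullback k f) hf.bijective

lemma IsCohomologyIso.symm_mem_homog {f : C(X, Y)} (hf : IsCohomologyIso k f) {n : ℕ} {x : H k X}
    (hx : x ∈ homog k X n) : hf.algEquiv.symm x ∈ homog k Y n := by
  obtain ⟨x, rfl⟩ := hx
  obtain ⟨y, rfl⟩ := (hf n).2 x
  refine ⟨y, ?_⟩
  rw [AlgEquiv.eq_symm_apply]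
  exact pullback_lof f n y

/-- The isomorphism `(g^*)⁻¹ f^*` induced by a roof of cohomology isomorphisms. -/
def roof {f : C(Z, X)} {g : C(Z, Y)} (hf : IsCohomologyIso k f) (hg : IsCohomologyIso k g) :
    H k X ≃ₐ[k] H k Y :=
  hf.algEquiv.trans hg.algEquiv.symm

lemma pullback_roof {f : C(Z, X)} {g : C(Z, Y)} (hf : IsCohomologyIso k f)
    (hg : IsCohomologyIso k g) (x : H k X) : pullback k g (roof hf hg x) = pullback k f x :=
  hg.algEquiv.apply_symm_apply _

lemma roof_mem_homog {f : C(Z, X)} {g : C(Z, Y)} (hf : IsCohomologyIso k f)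
    (hg : IsCohomologyIso k g) {n : ℕ} {x : H k X} (hx : x ∈ homog k X n) :
    roof hf hg x ∈ homog k Y n :=
  hg.symm_mem_homog (pullback_mem_homog f hx)

/-- Compatibility of roofs with pull-back along a morphism of roofs. -/
lemma roof_pullback {X' Y' Z' : Type u} [TopologicalSpace X'] [TopologicalSpace Y']
    [TopologicalSpace Z'] {f : C(Z, X)} {g : C(Z, Y)} {f' : C(Z', X')} {g' : C(Z', Y')}
    (hf : IsCohomologyIso k f) (hg : IsCohomologyIso k g) (hf' : IsCohomologyIso k f')
    (hg' : IsCohomologyIso k g') (a : C(X, X')) (b : C(Y, Y')) (c : C(Z, Z'))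
    (h₁ : a.comp f = f'.comp c) (h₂ : b.comp g = g'.comp c) (x : H k X') :
    roof hf hg (pullback k a x) = pullback k b (roof hf' hg' x) := by
  apply hg.bijective.1
  rw [pullback_roof, ← pullback_comp, ← pullback_comp, h₁, h₂, pullback_comp, pullback_comp,
    pullback_roof]

end GradedPullback

/-! ### Comparison maps between orbit spaces -/

section Comparison

variable {k : Type u} [CommRing k] {H S S' T : Type u} [Group H] [TopologicalSpace H]
  [IsTopologicalGroup H] [TopologicalSpace S] [TopologicalSpace S'] [TopologicalSpace T]
  [MulAction H S] [MulAction H S'] [MulAction H T] [ContinuousSMul H S] [ContinuousSMul H S']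
  [ContinuousSMul H T]

/-- The splitting `Φ` is arbitrary so that one statement serves both projections of `E × E'`, with
or without the factor `X`. -/
lemma isCohomologyIso_orbitSpaceMap [ContractibleSpace T] (h : HasLocalCoordinates H S)
    (Φ : S' ≃ₜ S × T) (f : C(S', S)) (hf : ∀ (g : H) (s : S'), f (g • s) = g • f s)
    (hΦ : ∀ s, (Φ s).1 = f s) (hΦ' : ∀ (g : H) (s : S'), Φ (g • s) = g • Φ s) :
    IsCohomologyIso k (orbitSpaceMap f hf) := fun n =>
  (h.isFibreBundle Φ f hf hΦ hΦ').pullbackDeg_bijective n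

/-- A coset representative acts through all of `G`, so naturality of `v_A` needs `f` to be
equivariant under `G` and not only under `R`. -/
lemma orbitSpaceMap_cosetInvSMul {G E Z : Type u} [Group G] [TopologicalSpace G] (R : Subgroup G)
    [TopologicalSpace E] [TopologicalSpace Z] [MulAction G E] [MulAction G Z] (f : C(Z, E))
    (hf : ∀ (g : G) (z : Z), f (g • z) = g • f z) (c : G ⧸ R) (z : Z) :
    cosetInvSMul R E c (f z) =
      orbitSpaceMap (H := R) f (fun g z => hf g z) (cosetInvSMul R Z c z) := by
  induction c using QuotientGroup.induction_on with
  | H g => exact congrArg (orbitMap R E) (hf g⁻¹ z).symm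

end Comparison

end

end EquivCoh

/-! ### Independence of the choice of `E` -/

theorem mainTheorem10 (k : Type u) [CommRing k]
    (G : Type u) [Group G] [TopologicalSpace G] [IsTopologicalGroup G] (L R : Subgroup G)
    (X : Type u) [TopologicalSpace X] [MulAction L X] [ContinuousSMul L X]
    (A : EquivCoh.TwistingMap L R X)
    (E : Type u) [TopologicalSpace E] [MulAction G E] [ContinuousSMul G E]
    (hLE : EquivCoh.IsUniversalPrincipalBundle L (EquivCoh.orbitMap L E))
    (hRE : EquivCoh.IsUniversalPrincipalBundle R (EquivCoh.orbitMap R E))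
    (E' : Type u) [TopologicalSpace E'] [MulAction G E'] [ContinuousSMul G E']
    (hLE' : EquivCoh.IsUniversalPrincipalBundle L (EquivCoh.orbitMap L E'))
    (hRE' : EquivCoh.IsUniversalPrincipalBundle R (EquivCoh.orbitMap R E')) :
    ∃ (ιL : EquivCoh.H k (EquivCoh.OrbitSpace L E) ≃ₐ[k] EquivCoh.H k (EquivCoh.OrbitSpace L E'))
      (ιR : EquivCoh.H k (EquivCoh.OrbitSpace R E) ≃ₐ[k] EquivCoh.H k (EquivCoh.OrbitSpace R E'))
      (μ : EquivCoh.EquivariantCohomology k E A ≃ₗ[k] EquivCoh.EquivariantCohomology k E' A),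
      (∀ n, ∀ a ∈ EquivCoh.homog k (EquivCoh.OrbitSpace L E) n,
        ιL a ∈ EquivCoh.homog k (EquivCoh.OrbitSpace L E') n) ∧
      (∀ n, ∀ b ∈ EquivCoh.homog k (EquivCoh.OrbitSpace R E) n,
        ιR b ∈ EquivCoh.homog k (EquivCoh.OrbitSpace R E') n) ∧
      (∀ n, ∀ m ∈ EquivCoh.EquivariantCohomology.homog k A E n,
        μ m ∈ EquivCoh.EquivariantCohomology.homog k A E' n) ∧
      (∀ (a : EquivCoh.H k (EquivCoh.OrbitSpace L E)) (m : EquivCoh.EquivariantCohomology k E A),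
        μ (a • m) = ιL a • μ m) ∧
      (∀ (m : EquivCoh.EquivariantCohomology k E A) (b : EquivCoh.H k (EquivCoh.OrbitSpace R E)),
        μ (MulOpposite.op b • m) = MulOpposite.op (ιR b) • μ m) := by
  have hE := hLE.contractible
  have hE' := hLE'.contractible
  let f : C(E × E', E) := ContinuousMap.fst
  let f' : C(E × E', E') := ContinuousMap.snd
  let F : C(X × (E × E'), X × E) := (ContinuousMap.id X).prodMap f
  let F' : C(X × (E × E'), X × E') := (ContinuousMap.id X).prodMap f'
  -- The leg towards `E` has fibre `E'`, and the leg towards `E'` has fibre `E`.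
  let Φ : X × (E × E') ≃ₜ (X × E) × E' := (Homeomorph.prodAssoc X E E').symm
  let Φ' : X × (E × E') ≃ₜ (X × E') × E :=
    ((Homeomorph.refl X).prodCongr (Homeomorph.prodComm E E')).trans
      (Homeomorph.prodAssoc X E' E).symm
  have cL := hLE.toIsPrincipalBundle.hasLocalCoordinates
  have cR := hRE.toIsPrincipalBundle.hasLocalCoordinates
  have cL' := hLE'.toIsPrincipalBundle.hasLocalCoordinates
  have cR' := hRE'.toIsPrincipalBundle.hasLocalCoordinates
  have iL := EquivCoh.isCohomologyIso_orbitSpaceMap (k := k) cL (Homeomorph.refl (E × E')) f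
    (fun _ _ => rfl) (fun _ => rfl) (fun _ _ => rfl)
  have iR := EquivCoh.isCohomologyIso_orbitSpaceMap (k := k) cR (Homeomorph.refl (E × E')) f
    (fun _ _ => rfl) (fun _ => rfl) (fun _ _ => rfl)
  have iL' := EquivCoh.isCohomologyIso_orbitSpaceMap (k := k) cL' (Homeomorph.prodComm E E') f'
    (fun _ _ => rfl) (fun _ => rfl) (fun _ _ => rfl)
  have iR' := EquivCoh.isCohomologyIso_orbitSpaceMap (k := k) cR' (Homeomorph.prodComm E E') f'
    (fun _ _ => rfl) (fun _ => rfl) (fun _ _ => rfl)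
  have iX := EquivCoh.isCohomologyIso_orbitSpaceMap (k := k)
    (cL.of_map (ContinuousMap.snd : C(X × E, E)) fun _ _ => rfl) Φ F
    (fun _ _ => rfl) (fun _ => rfl) (fun _ _ => rfl)
  have iX' := EquivCoh.isCohomologyIso_orbitSpaceMap (k := k)
    (cL'.of_map (ContinuousMap.snd : C(X × E', E')) fun _ _ => rfl) Φ' F'
    (fun _ _ => rfl) (fun _ => rfl) (fun _ _ => rfl)
  let μ := EquivCoh.roof iX iX'
  refine ⟨EquivCoh.roof iL iL', EquivCoh.roof iR iR', μ.toLinearEquiv,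
    fun n a ha => EquivCoh.roof_mem_homog iL iL' ha, fun n b hb => EquivCoh.roof_mem_homog iR iR' hb,
    fun n m hm => EquivCoh.roof_mem_homog iX iX' hm, fun a m => ?_, fun m b => ?_⟩
  · have h := EquivCoh.roof_pullback iX iX' iL iL' (EquivCoh.can L X E) (EquivCoh.can L X E')
      (EquivCoh.can L X (E × E'))
      (by ext z; induction z using Quotient.inductionOn; rfl)
      (by ext z; induction z using Quotient.inductionOn; rfl) a
    -- As `μ` comes from an algebra isomorphism, compatibility with the action reduces to naturality
    -- of roofs along `can`.
    exact (map_mul μ _ _).trans (congrArg (· * μ m) h)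
  · have h := EquivCoh.roof_pullback iX iX' iR iR' (EquivCoh.twistedProj A E)
      (EquivCoh.twistedProj A E') (EquivCoh.twistedProj A (E × E'))
      (by
        ext z
        induction z using Quotient.inductionOn with
        | h z => exact EquivCoh.orbitSpaceMap_cosetInvSMul R f (fun _ _ => rfl) _ _)
      (by
        ext z
        induction z using Quotient.inductionOn with
        | h z => exact EquivCoh.orbitSpaceMap_cosetInvSMul R f' (fun _ _ => rfl) _ _) b
    exact (map_mul μ _ _).trans (congrArg (μ m * ·) h)
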